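/- Let $\mathfrak g=\mathfrak{sl}(\infty)$ be the complex Lie algebra of traceless $\mathbb Z_{>0}\times\mathbb Z_{>0}$-matrices with finitely many nonzero entries, with matrix units $E_{ij}$, let $\mathfrak h$ be the Cartan subalgebra of diagonal matrices in $\mathfrak g$, and let $V=\bigoplus_{i\ge 1}\mathbb C e_i$ be the natural module. Let $\prec$ be a strict partial order on $\mathbb Z_{>0}$, put $[i]:=\{i\}\cup\{j : j \text{ is not comparable with } i\}$, and assume that $\prec$ is admissible, i.e. that $[i]\ne[j]$ implies $[i]\cap[j]=\emptyset$. Let $\mathfrak l(\prec)$ be the subalgebra generated by $\mathfrak h$ and all $E_{ij}$ with $i\neq j$, $[i]=[j]$, let $\mathfrak u(\prec)$ be the subalgebra generated by all $E_{ij}$ with $i\prec j$, and let $\mathfrak p(\prec)=\mathfrak l(\prec)\oplus\mathfrak u(\prec)$. Put $V_{[p]}:=\langle e_i : i\in[p]\rangle_{\mathbb C}$, an $\mathfrak l(\prec)$-submodule of $V$. Weight modules are modules that are the direct sum of their $\mathfrak h$-weight spaces, all of them finite-dimensional. A simple weight $\mathfrak g$-module $M$ is called $\mathfrak p(\prec)$-aligned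 if it is isomorphic to the simple quotient of $U(\mathfrak g)\otimes_{U(\mathfrak p(\prec))}S$ for some simple weight $\mathfrak l(\prec)$-module $S$, on which $\mathfrak u(\prec)$ acts by zero. Put $M^{\mathfrak u(\prec)}=\{m\in M : \mathfrak u(\prec)\cdot m=0\}$. For a partition $\nu$ with at most $\dim W$ parts and $W=V$ or $W=V_{[p]}$, let $S^\nu W$ be the module generated, in the tensor power $W^{\otimes|\nu|}$, by the highest weight vector of weight $\nu$ with respect to the usual order of the basis vectors $e_i$ of $W$ (tensor positions are the boxes of the Young diagram of $\nu$; put the $r$-th basis vector of $W$ into every box of the $r$-th row and antisymmetrize along the columns). Thus $S^\nu V=\varinjlim_n L_{\mathfrak b_n}(\nu)$ is the direct limit of the simple $\mathfrak{sl}(n+1)$-modules with highest weight $\nu$, and $S^\nu V_{[p]}$ is its analogue for the set $[p]$; $\mathfrak l(\prec)$ acts on $S^\nu V_{[p]}$ through its action on $V_{[p]}$. Let $\mu=(\mu_1\ge\dots\ge\mu_k)$ with $k\ge1$ and $\mu_k\geq 1$ be a partition, and suppose that $S^\mu V$ is $\mathfrak p(\prec)$-aligned. (1) There are distinct $i_1,\dots,i_k\in\mathbb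 Z_{>0}$ such that $i_s\prec i_t$ implies $s<t$, and such that no $m\in\mathbb Z_{>0}\setminus\{i_1,\dots,i_k\}$ satisfies $m\prec i_s$ for some $s$. (2) For every such choice of $i_1,\dots,i_k$ let $[p_1]\prec\dots\prec[p_l]$ be the distinct blocks among $[i_1],\dots,[i_k]$, and let $\mu[p_j]$ be the partition formed by the parts $\mu_s$ with $i_s\in[p_j]$. Then there is an isomorphism of $\mathfrak l(\prec)$-modules $$(S^\mu V)^{\mathfrak u(\prec)}\;\cong\;\Big(S^{\mu[p_1]}V_{[p_1]}\boxtimes\dots\boxtimes S^{\mu[p_l]}V_{[p_l]}\Big)\boxtimes\mathbb C,$$ where $\mathfrak l(\prec)$ acts on the right-hand side by the Leibniz rule and trivially on $\mathbb C$ (so that $\mathfrak{sl}([p_j])$ acts on the $j$-th factor only, and $\mathfrak{sl}([q])$ acts trivially for every other block $[q]$). -/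

import Mathlib

open scoped TensorProduct

noncomputable section

attribute [local instance 100] LieRing.ofAssociativeRing

/-! ### Lie algebra actions on tensor products -/

namespace TensorAction

section

variable {ι : Type} [DecidableEq ι] {L : Type} [LieRing L] [LieAlgebra ℂ L]
  {M : ι → Type} [∀ i, AddCommGroup (M i)] [∀ i, Module ℂ (M i)]

/-- The operator `1 ⊗ ⋯ ⊗ f ⊗ ⋯ ⊗ 1` acting by `f` on the `i`-th tensor factor. -/
def onFactor (i : ι) (f : Module.End ℂ (M i)) : Module.End ℂ (⨂[ℂ] j, M j) :=
  PiTensorProduct.map (Function.update (fun _ => LinearMap.id) i f)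

theorem onFactor_tprod (i : ι) (f : Module.End ℂ (M i)) (m : ∀ j, M j) :
    onFactor i f (PiTensorProduct.tprod ℂ m) =
      PiTensorProduct.tprod ℂ (Function.update m i (f (m i))) := by
  unfold onFactor
  rw [PiTensorProduct.map_tprod]
  congr 1
  funext j
  by_cases h : j = i
  · subst h; simp
  · simp [h]

theorem onFactor_add (i : ι) (f g : Module.End ℂ (M i)) :
    onFactor i (f + g) = onFactor i f + onFactor i g := by
  unfold onFactor
  rw [PiTensorProduct.map_update_add]

theorem onFactor_smul (i : ι) (c : ℂ) (f : Module.End ℂ (M i)) :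
    onFactor i (c • f) = c • onFactor i f := by
  unfold onFactor
  rw [PiTensorProduct.map_update_smul]

theorem onFactor_sub (i : ι) (f g : Module.End ℂ (M i)) :
    onFactor i (f - g) = onFactor i f - onFactor i g := by
  rw [eq_sub_iff_add_eq, ← onFactor_add, sub_add_cancel]

theorem onFactor_mul (i : ι) (f g : Module.End ℂ (M i)) :
    onFactor i f * onFactor i g = onFactor i (f * g) := by
  refine PiTensorProduct.ext (MultilinearMap.ext fun m => ?_)
  simp [onFactor_tprod]

theorem onFactor_commute {i j : ι} (h : i ≠ j) (f : Module.End ℂ (M i))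
    (g : Module.End ℂ (M j)) :
    onFactor i f * onFactor j g = onFactor j g * onFactor i f := by
  refine PiTensorProduct.ext (MultilinearMap.ext fun m => ?_)
  simp [onFactor_tprod, h, h.symm, Function.update_comm h]

variable [Fintype ι] [∀ i, LieRingModule L (M i)] [∀ i, LieModule ℂ L (M i)]

/-- The Leibniz action `x ↦ ∑ i, 1 ⊗ ⋯ ⊗ x ⊗ ⋯ ⊗ 1` of a Lie algebra on `⨂ M i`. -/
def leibniz : L →ₗ⁅ℂ⁆ Module.End ℂ (⨂[ℂ] j, M j) where
  toFun x := ∑ i, onFactor i (LieModule.toEnd ℂ L (M i) x)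
  map_add' x y := by simp [onFactor_add, Finset.sum_add_distrib]
  map_smul' c x := by simp [onFactor_smul, Finset.smul_sum]
  map_lie' {x y} := by
    rw [Ring.lie_def, Finset.sum_mul_sum, Finset.sum_mul_sum]
    conv_rhs => rw [Finset.sum_comm]
    rw [← Finset.sum_sub_distrib]
    refine Finset.sum_congr rfl fun i _ => ?_
    rw [← Finset.sum_sub_distrib, Finset.sum_eq_single i]
    · rw [onFactor_mul, onFactor_mul, ← onFactor_sub, LieHom.map_lie, Ring.lie_def]
    · intro j _ hj
      rw [onFactor_commute hj, sub_self]
    · simp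

instance : LieRingModule L (⨂[ℂ] j, M j) :=
  LieRingModule.compLieHom (⨂[ℂ] j, M j) (leibniz (L := L) (M := M))

instance : LieModule ℂ L (⨂[ℂ] j, M j) :=
  LieModule.compLieHom (⨂[ℂ] j, M j) (leibniz (L := L) (M := M))

theorem lie_tprod (x : L) (m : ∀ j, M j) :
    ⁅x, PiTensorProduct.tprod ℂ m⁆ =
      ∑ i, PiTensorProduct.tprod ℂ (Function.update m i ⁅x, m i⁆) := by
  change leibniz (L := L) (M := M) x (PiTensorProduct.tprod ℂ m) = _
  simp [leibniz, onFactor_tprod, LinearMap.sum_apply]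

end

end TensorAction

namespace SlInf

/-! ### The Lie algebra `𝔰𝔩(∞)` and its natural module -/

/-- The natural module: the complex vector space with basis `e 0, e 1, e 2, …`. -/
def V : Type := ℕ →₀ ℂ

instance : AddCommGroup V := inferInstanceAs (AddCommGroup (ℕ →₀ ℂ))

instance : Module ℂ V := inferInstanceAs (Module ℂ (ℕ →₀ ℂ))

/-- The standard basis of `V`. -/
def e : Module.Basis ℕ ℂ V := ⟨LinearEquiv.refl ℂ V⟩

/-- The matrix unit `E i j`, with `E i j (e j) = e i` and `E i j (e m) = 0` for `m ≠ j`. -/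
def E (i j : ℕ) : Module.End ℂ V := (e.coord j).smulRight (e i)

theorem E_apply (i j : ℕ) (v : V) : E i j v = e.coord j v • e i := rfl

theorem coord_e (i j : ℕ) : e.coord j (e i) = if i = j then 1 else 0 := by
  rw [Module.Basis.coord_apply, Module.Basis.repr_self, Finsupp.single_apply]

/-- `𝔰𝔩(∞)`: the finitary traceless matrices. Since `𝔰𝔩(n + 1)` is generated by its off-diagonal
matrix units, so is the union `𝔰𝔩(∞)` of the `𝔰𝔩(n + 1)`. -/
def sl : LieSubalgebra ℂ (Module.End ℂ V) :=
  LieSubalgebra.lieSpan ℂ (Module.End ℂ V) {x | ∃ i j, i ≠ j ∧ x = E i j}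

/-- The Cartan subalgebra of traceless finitary diagonal matrices, spanned by `E i i - E j j`. -/
def cartan : Submodule ℂ sl :=
  Submodule.span ℂ {x | ∃ i j, (x : Module.End ℂ V) = E i i - E j j}

/-! ### Admissible partial orders and their parabolic subalgebras -/

/-- The block `[i]` of `i` for a strict order: `i` itself and all elements incomparable to `i`. -/
def block (lt : ℕ → ℕ → Prop) (i : ℕ) : Set ℕ := {j | j = i ∨ (¬ lt i j ∧ ¬ lt j i)}

/-- A strict partial order is admissible if distinct blocks are disjoint. -/
structure AdmissibleOrder where
  lt : ℕ → ℕ → Prop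
  irrefl : ∀ i, ¬ lt i i
  trans : ∀ i j m, lt i j → lt j m → lt i m
  admissible : ∀ i j, block lt i ≠ block lt j → Disjoint (block lt i) (block lt j)

namespace AdmissibleOrder

variable (P : AdmissibleOrder)

theorem mem_block_self (i : ℕ) : i ∈ block P.lt i := Or.inl rfl

theorem block_eq {i j : ℕ} (h : j ∈ block P.lt i) : block P.lt j = block P.lt i := by
  by_contra hne
  exact Set.disjoint_left.1 (P.admissible j i hne) (P.mem_block_self j) h

theorem mem_block_symm {i j : ℕ} (h : j ∈ block P.lt i) : i ∈ block P.lt j := by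
  rw [P.block_eq h]; exact P.mem_block_self i

theorem not_lt_of_mem_block {i j : ℕ} (h : j ∈ block P.lt i) : ¬ P.lt i j := by
  rcases h with h | h
  · subst h; exact P.irrefl _
  · exact h.1

theorem lt_or_lt_of_notMem {i j : ℕ} (h : j ∉ block P.lt i) : P.lt i j ∨ P.lt j i := by
  by_contra hc
  exact h (Or.inr ⟨fun h' => hc (Or.inl h'), fun h' => hc (Or.inr h')⟩)

theorem lt_of_mem_left {a b j : ℕ} (hab : b ∈ block P.lt a) (h : P.lt b j) : P.lt a j := by
  have hj : j ∉ block P.lt a := fun hj =>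
    P.not_lt_of_mem_block (by rw [P.block_eq hab]; exact hj) h
  rcases P.lt_or_lt_of_notMem hj with h1 | h1
  · exact h1
  · exact absurd (P.trans _ _ _ h h1) (P.not_lt_of_mem_block (P.mem_block_symm hab))

theorem lt_of_mem_right {a b i : ℕ} (hab : b ∈ block P.lt a) (h : P.lt i a) : P.lt i b := by
  have hi : b ∉ block P.lt i := fun hb => by
    have h1 : i ∈ block P.lt a := by
      rw [← P.block_eq hab]; exact P.mem_block_symm hb
    exact P.not_lt_of_mem_block (P.mem_block_symm h1) h
  rcases P.lt_or_lt_of_notMem hi with h1 | h1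
  · exact h1
  · exact absurd (P.trans _ _ _ h1 h) (P.not_lt_of_mem_block (P.mem_block_symm hab))

/-- The reductive component `𝔩(≺)` of the parabolic subalgebra `𝔭(≺) = 𝔩(≺) ⊕ 𝔲(≺)`: generated by
the Cartan subalgebra and the root vectors `E i j` with `i ≠ j` in one block. -/
def levi : LieSubalgebra ℂ sl :=
  LieSubalgebra.lieSpan ℂ sl
    ({x | x ∈ cartan} ∪ {x | ∃ i j, i ≠ j ∧ j ∈ block P.lt i ∧ (x : Module.End ℂ V) = E i j})

/-- The locally nilpotent radical `𝔲(≺)`: generated by the root vectors `E i j` with `i ≺ j`. -/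
def nilradical : LieSubalgebra ℂ sl :=
  LieSubalgebra.lieSpan ℂ sl {x | ∃ i j, P.lt i j ∧ (x : Module.End ℂ V) = E i j}

end AdmissibleOrder

/-! ### Weight modules, generalized Verma modules, aligned modules -/

/-- The weight space of weight `lam` for a subspace `H` of `L`. -/
def weightSpace {L : Type} [LieRing L] [LieAlgebra ℂ L] (H : Submodule ℂ L)
    (M : Type) [AddCommGroup M] [Module ℂ M] [LieRingModule L M] [LieModule ℂ L M]
    (lam : H →ₗ[ℂ] ℂ) : Submodule ℂ M where
  carrier := {m | ∀ h : H, ⁅(h : L), m⁆ = lam h • m}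
  add_mem' {a b} ha hb h := by rw [lie_add, ha h, hb h, smul_add]
  zero_mem' h := by simp
  smul_mem' c a ha h := by rw [lie_smul, ha h, smul_comm]

/-- A weight module with finite-dimensional weight spaces. -/
def IsWeightModule {L : Type} [LieRing L] [LieAlgebra ℂ L] (H : Submodule ℂ L)
    (M : Type) [AddCommGroup M] [Module ℂ M] [LieRingModule L M] [LieModule ℂ L M] : Prop :=
  (⨆ lam : H →ₗ[ℂ] ℂ, weightSpace H M lam) = ⊤ ∧
    ∀ lam : H →ₗ[ℂ] ℂ, FiniteDimensional ℂ (weightSpace H M lam)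

namespace AdmissibleOrder

variable (P : AdmissibleOrder)

/-- The enveloping algebra of `𝔰𝔩(∞)`. -/
abbrev U : Type := UniversalEnvelopingAlgebra ℂ sl

section

variable (S : Type) [AddCommGroup S] [Module ℂ S] [LieRingModule P.levi S] [LieModule ℂ P.levi S]

/-- The relations that turn `U(𝔤) ⊗_ℂ S` into `U(𝔤) ⊗_{U(𝔭)} S`, where `𝔭 = 𝔩 ⊕ 𝔲` acts on the
`𝔩`-module `S` through `𝔲 · S = 0`. -/
def vermaRelations : Submodule U (U ⊗[ℂ] S) :=
  Submodule.span U
    ({t | ∃ (x : P.levi) (s : S),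
        t = UniversalEnvelopingAlgebra.ι ℂ (x : sl) ⊗ₜ[ℂ] s - 1 ⊗ₜ[ℂ] ⁅x, s⁆} ∪
      {t | ∃ (y : P.nilradical) (s : S),
        t = UniversalEnvelopingAlgebra.ι ℂ (y : sl) ⊗ₜ[ℂ] s})

/-- The generalized Verma module `M_𝔭(S) = U(𝔤) ⊗_{U(𝔭)} S`. -/
abbrev GenVerma : Type := (U ⊗[ℂ] S) ⧸ P.vermaRelations S

end

/-- The Cartan subalgebra, as a subspace of `𝔩(≺)`. -/
def leviCartan : Submodule ℂ P.levi := cartan.comap (P.levi.incl : P.levi →ₗ[ℂ] sl)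

/-- `M` is `𝔭(≺)`-aligned: `M` is a simple weight `𝔤`-module that is isomorphic to a (necessarily
the unique) simple quotient of a generalized Verma module `M_𝔭(S)`, for a simple weight
`𝔩`-module `S`. As `M` is simple this means that there is a `𝔤`-linear surjection `M_𝔭(S) → M`. -/
def IsAligned (M : Type) [AddCommGroup M] [Module ℂ M] [LieRingModule sl M] [LieModule ℂ sl M] :
    Prop :=
  LieModule.IsIrreducible ℂ sl M ∧ IsWeightModule cartan M ∧
    ∃ (S : Type) (_ : AddCommGroup S) (_ : Module ℂ S) (_ : LieRingModule P.levi S)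
      (_ : LieModule ℂ P.levi S),
      LieModule.IsIrreducible ℂ P.levi S ∧
      IsWeightModule (P.leviCartan) S ∧
      ∃ φ : P.GenVerma S →ₗ[ℂ] M, Function.Surjective φ ∧
        ∀ (x : sl) (w : P.GenVerma S), φ (UniversalEnvelopingAlgebra.ι ℂ x • w) = ⁅x, φ w⁆

/-! ### The `𝔩(≺)`-modules `M^𝔲(≺)` and `V_[p]` -/

end AdmissibleOrder

section

variable {L : Type} [LieRing L] [LieAlgebra ℂ L]
  {M : Type} [AddCommGroup M] [Module ℂ M] [LieRingModule L M] [LieModule ℂ L M]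

/-- The Lie subalgebra of all elements of `L` that preserve a subspace `N`. -/
def stabilizer (L : Type) [LieRing L] [LieAlgebra ℂ L] [LieRingModule L M] [LieModule ℂ L M]
    (N : Submodule ℂ M) : LieSubalgebra ℂ L where
  carrier := {x | ∀ m ∈ N, ⁅x, m⁆ ∈ N}
  add_mem' {a b} ha hb m hm := by rw [add_lie]; exact N.add_mem (ha m hm) (hb m hm)
  zero_mem' m _ := by rw [zero_lie]; exact N.zero_mem
  smul_mem' c a ha m hm := by rw [smul_lie]; exact N.smul_mem c (ha m hm)
  lie_mem' {a b} ha hb m hm := by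
    rw [lie_lie]; exact N.sub_mem (ha _ (hb m hm)) (hb _ (ha m hm))

theorem mem_stabilizer {N : Submodule ℂ M} {x : L} :
    x ∈ stabilizer L N ↔ ∀ m ∈ N, ⁅x, m⁆ ∈ N := Iff.rfl

/-- The Lie subalgebra of all elements of `L` that annihilate `m`. -/
def annihilator (L : Type) [LieRing L] [LieAlgebra ℂ L] [LieRingModule L M] [LieModule ℂ L M]
    (m : M) : LieSubalgebra ℂ L where
  carrier := {x | ⁅x, m⁆ = 0}
  add_mem' {a b} ha hb := by
    change ⁅a + b, m⁆ = 0
    rw [add_lie, show ⁅a, m⁆ = 0 from ha, show ⁅b, m⁆ = 0 from hb, add_zero]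
  zero_mem' := zero_lie m
  smul_mem' c a ha := by
    change ⁅c • a, m⁆ = 0
    rw [smul_lie, show ⁅a, m⁆ = 0 from ha, smul_zero]
  lie_mem' {a b} ha hb := by
    change ⁅⁅a, b⁆, m⁆ = 0
    rw [lie_lie, show ⁅a, m⁆ = 0 from ha, show ⁅b, m⁆ = 0 from hb, lie_zero, lie_zero, sub_zero]

end

theorem E_mul_E (a b i j : ℕ) : E a b * E i j = if i = b then E a j else 0 := by
  refine LinearMap.ext fun v => ?_
  rw [Module.End.mul_apply, E_apply, E_apply, map_smul, coord_e]
  split_ifs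
  · rw [smul_eq_mul, mul_one, E_apply]
  · rw [smul_zero, zero_smul, LinearMap.zero_apply]

theorem E_lie_E (a b i j : ℕ) :
    ⁅E a b, E i j⁆ = (if i = b then E a j else 0) - (if a = j then E i b else 0) := by
  rw [Ring.lie_def, E_mul_E, E_mul_E]

namespace AdmissibleOrder

variable (P : AdmissibleOrder)

section

variable (M : Type) [AddCommGroup M] [Module ℂ M] [LieRingModule sl M] [LieModule ℂ sl M]

/-- The subspace `M^𝔲` of vectors annihilated by `𝔲(≺)`. -/
def invariantSpace : Submodule ℂ M where
  carrier := {m | ∀ y ∈ P.nilradical, ⁅y, m⁆ = 0}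
  add_mem' {a b} ha hb y hy := by rw [lie_add, ha y hy, hb y hy, add_zero]
  zero_mem' y _ := lie_zero y
  smul_mem' c a ha y hy := by rw [lie_smul, ha y hy, smul_zero]

variable {M}

theorem mem_invariantSpace_of {m : M}
    (h : ∀ (y : sl) (i j : ℕ), P.lt i j → (y : Module.End ℂ V) = E i j → ⁅y, m⁆ = 0) :
    m ∈ P.invariantSpace M := by
  intro y hy
  have : P.nilradical ≤ annihilator sl m :=
    LieSubalgebra.lieSpan_le.2 (by rintro x ⟨i, j, hij, hx⟩; exact h x i j hij hx)
  exact this hy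

theorem E_mem_nilradical {y : sl} {i j : ℕ} (h : P.lt i j) (hy : (y : Module.End ℂ V) = E i j) :
    y ∈ P.nilradical :=
  LieSubalgebra.subset_lieSpan ⟨i, j, h, hy⟩

theorem bracket_mem {x y : sl} {i j : ℕ} (hij : P.lt i j) (hy : (y : Module.End ℂ V) = E i j)
    (hx : x ∈ cartan ∨ ∃ a b, a ≠ b ∧ b ∈ block P.lt a ∧ (x : Module.End ℂ V) = E a b) :
    ⁅x, y⁆ ∈ P.nilradical := by
  rcases hx with hx | ⟨a, b, hab, hb, hx⟩
  · induction hx using Submodule.span_induction with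
    | mem x hx =>
      obtain ⟨a, b, hx⟩ := hx
      have key : ∃ c : ℂ, ⁅x, y⁆ = c • y := by
        refine ⟨(if i = a then 1 else 0) - (if a = j then 1 else 0)
          - ((if i = b then 1 else 0) - (if b = j then 1 else 0)), Subtype.ext ?_⟩
        change ⁅(x : Module.End ℂ V), (y : Module.End ℂ V)⁆ = _ • (y : Module.End ℂ V)
        rw [hx, hy, Ring.lie_def, sub_mul, mul_sub, E_mul_E, E_mul_E, E_mul_E, E_mul_E]
        simp only [sub_smul, ite_smul, one_smul, zero_smul]
        split_ifs <;> subst_vars <;> simp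
      obtain ⟨c, hc⟩ := key
      rw [hc]
      exact P.nilradical.smul_mem c (P.E_mem_nilradical hij hy)
    | zero => rw [zero_lie]; exact P.nilradical.zero_mem
    | add u v _ _ hu hv => rw [add_lie]; exact P.nilradical.add_mem hu hv
    | smul c u _ hu => rw [smul_lie]; exact P.nilradical.smul_mem c hu
  · have key : ((⁅x, y⁆ : sl) : Module.End ℂ V) =
        (if i = b then E a j else 0) - (if a = j then E i b else 0) := by
      rw [LieSubalgebra.coe_bracket, hx, hy, E_lie_E]
    by_cases h1 : i = b
    · have haj : P.lt a j := P.lt_of_mem_left hb (by rw [← h1]; exact hij)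
      have h2 : a ≠ j := fun h => P.irrefl a (by rw [← h] at haj; exact haj)
      rw [if_pos h1, if_neg h2, sub_zero] at key
      exact P.E_mem_nilradical haj key
    · by_cases h2 : a = j
      · have hib : P.lt i b := P.lt_of_mem_right hb (by rw [h2]; exact hij)
        rw [if_neg h1, if_pos h2, zero_sub] at key
        have h3 : -⁅x, y⁆ ∈ P.nilradical :=
          P.E_mem_nilradical hib (by
            change -((⁅x, y⁆ : sl) : Module.End ℂ V) = _
            rw [key, neg_neg])
        simpa using P.nilradical.neg_mem h3
      · rw [if_neg h1, if_neg h2, sub_zero] at key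
        have h0 : ⁅x, y⁆ = 0 := Subtype.ext key
        rw [h0]; exact P.nilradical.zero_mem

theorem levi_le_stabilizer_invariantSpace : P.levi ≤ stabilizer sl (P.invariantSpace M) := by
  refine LieSubalgebra.lieSpan_le.2 ?_
  intro x hx m hm
  refine P.mem_invariantSpace_of fun y i j hij hy => ?_
  have h1 : ⁅y, m⁆ = 0 := hm y (P.E_mem_nilradical hij hy)
  have h2 : ⁅⁅x, y⁆, m⁆ = 0 := hm _ (P.bracket_mem hij hy hx)
  rw [lie_lie, h1, lie_zero, zero_sub, neg_eq_zero] at h2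
  exact h2

variable (M) in
/-- `M^𝔲(≺)` as an `𝔩(≺)`-submodule of `M`. -/
def invariants : LieSubmodule ℂ P.levi M where
  toSubmodule := P.invariantSpace M
  lie_mem {x m} hm := P.levi_le_stabilizer_invariantSpace x.2 m hm

end

/-- The span of the `e i` with `i ∈ [p]`. -/
def blockSpan (p : ℕ) : Submodule ℂ V := Submodule.span ℂ (e '' block P.lt p)

theorem levi_le_stabilizer_blockSpan (p : ℕ) : P.levi ≤ stabilizer sl (P.blockSpan p) := by
  have hE : ∀ i j : ℕ, j ∈ block P.lt i → ∀ v ∈ P.blockSpan p, E i j v ∈ P.blockSpan p := by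
    intro i j hij v hv
    induction hv using Submodule.span_induction with
    | mem v hv =>
      obtain ⟨m, hm, rfl⟩ := hv
      rw [E_apply, coord_e]
      split_ifs with h
      · subst h
        rw [one_smul]
        refine Submodule.subset_span ⟨i, ?_, rfl⟩
        rw [← P.block_eq hm]
        exact P.mem_block_symm hij
      · rw [zero_smul]; exact Submodule.zero_mem _
    | zero => rw [map_zero]; exact Submodule.zero_mem _
    | add u v _ _ hu hv => rw [map_add]; exact Submodule.add_mem _ hu hv
    | smul c u _ hu => rw [map_smul]; exact Submodule.smul_mem _ c hu
  refine LieSubalgebra.lieSpan_le.2 ?_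
  rintro x (hx | ⟨i, j, -, hij, hx⟩)
  · induction hx using Submodule.span_induction with
    | mem x hx =>
      obtain ⟨a, b, hx⟩ := hx
      intro v hv
      change (x : Module.End ℂ V) v ∈ _
      rw [hx, LinearMap.sub_apply]
      exact Submodule.sub_mem _ (hE a a (P.mem_block_self a) v hv)
        (hE b b (P.mem_block_self b) v hv)
    | zero => exact LieSubalgebra.zero_mem _
    | add u v _ _ hu hv => exact LieSubalgebra.add_mem _ hu hv
    | smul c u _ hu => exact LieSubalgebra.smul_mem _ c hu
  · intro v hv
    change (x : Module.End ℂ V) v ∈ _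
    rw [hx]
    exact hE i j hij v hv

/-- `V_[p]`, the span of the `e i` with `i ∈ [p]`, as an `𝔩(≺)`-submodule of `V`. It is the natural
module of `𝔰𝔩([p])`, and `𝔰𝔩([q])` acts on it by zero when `[q] ≠ [p]`. -/
def blockSpace (p : ℕ) : LieSubmodule ℂ P.levi V where
  toSubmodule := P.blockSpan p
  lie_mem {x v} hv := P.levi_le_stabilizer_blockSpan p x.2 v hv

open Classical in
/-- The basis vectors of `V_[p]`, enumerated by the usual order of `ℕ`: `blockBasis p r` is `e i`
for the `r`-th element `i` of `[p]` (and `0` if `[p]` has at most `r` elements). -/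
def blockBasis (p r : ℕ) : P.blockSpace p :=
  if h : Nat.nth (· ∈ block P.lt p) r ∈ block P.lt p then
    ⟨e (Nat.nth (· ∈ block P.lt p) r), Submodule.subset_span ⟨_, h, rfl⟩⟩
  else 0

end AdmissibleOrder

/-! ### The modules `S^ν W` -/

/-- The boxes of the Young diagram with row lengths `ν`: the box `⟨r, c⟩` is in row `r` and
column `c`. -/
abbrev Box (ν : List ℕ) : Type := Σ r : Fin ν.length, Fin (ν.get r)

section

variable {W : Type} [AddCommGroup W] [Module ℂ W]

/-- In the tensor power of `W` indexed by the boxes of `ν`, the highest weight vector of weight `ν`: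
put the vector `b r` into every box of row `r` and antisymmetrize along the columns. -/
def highestWeightVector (b : ℕ → W) (ν : List ℕ) : ⨂[ℂ] _ : Box ν, W :=
  ∑ σ : Equiv.Perm (Box ν) with ∀ c, ((σ c).2 : ℕ) = (c.2 : ℕ),
    (Equiv.Perm.sign σ : ℤ) • PiTensorProduct.tprod ℂ fun c => b (σ c).1

/-- `S^ν W`, for an `L`-module `W` with ordered basis `b 0, b 1, …` and a partition `ν` with at most
`dim W` parts: the `L`-submodule of the tensor power of `W` that is generated by the highest weight
vector of weight `ν`. For `L = 𝔰𝔩(n + 1)` and its natural module this is the simple module with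
highest weight `ν` for the Borel subalgebra of the usual order, and the highest weight vectors match
for all `n`; so for `L = 𝔰𝔩(∞)` and `W = V` it is the union of these simple modules. -/
def schur (L : Type) [LieRing L] [LieAlgebra ℂ L] [LieRingModule L W] [LieModule ℂ L W]
    (b : ℕ → W) (ν : List ℕ) : LieSubmodule ℂ L (⨂[ℂ] _ : Box ν, W) :=
  LieSubmodule.lieSpan ℂ L {highestWeightVector b ν}

end

/-- The `𝔰𝔩(∞)`-module `S^μ V`. -/
abbrev SV (μ : List ℕ) : Type := schur sl e μ

namespace AdmissibleOrder

variable (P : AdmissibleOrder)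

/-- The `𝔩(≺)`-module `S^ν V_[p]`. -/
abbrev SBlock (p : ℕ) (ν : List ℕ) : Type := schur P.levi (P.blockBasis p) ν

/-! ### Left ends -/

/-- The distinct numbers `i 0, …, i (k - 1)` form, in this order, the left end of a linear order that
refines `≺`. -/
structure IsLeftEnd {k : ℕ} (i : Fin k → ℕ) : Prop where
  injective : Function.Injective i
  lt_of_lt : ∀ s t, P.lt (i s) (i t) → s < t
  not_lt : ∀ m, (∀ s, i s ≠ m) → ∀ s, ¬ P.lt m (i s)

/-- An index set for the distinct blocks among `[i 0], …, [i (k - 1)]`: the first index of each. -/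
abbrev BlockIndex {k : ℕ} (i : Fin k → ℕ) : Type :=
  {j : Fin k // ∀ s < j, i s ∉ block P.lt (i j)}

instance {k : ℕ} (i : Fin k → ℕ) : Fintype (P.BlockIndex i) := Fintype.ofFinite _

open Classical in
/-- The partition `μ[p]`, formed by the parts `μ_s` with `i s ∈ [p]`, in their order. -/
def subPartition (μ : List ℕ) (i : Fin μ.length → ℕ) (p : ℕ) : List ℕ :=
  ((List.finRange μ.length).filter fun s => i s ∈ block P.lt p).map μ.get

end AdmissibleOrder

end SlInf

end

/-! Everything takes place inside the tensor power of `V` indexed by the boxes of `μ`. There `𝔰𝔩(∞)`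
acts by derivations, which commute with permutations of boxes. An extremal vector puts `e (i r)`
into the boxes of row `r` and antisymmetrizes along columns. Since `exp` of a root vector acts on
the tensor power by `1 + E a b` in every factor, a stable subspace that contains one extremal vector
contains all of them, and `S^μ V` may be generated by any one (`extremal_mem`).

Existence of a left end. The image of `1 ⊗ S` in an aligned module is a nonzero space of
`𝔲(≺)`-invariants. In an invariant tensor, the indices of a nonzero coordinate form a set closed
downwards under `≺`; column antisymmetry makes the entries of the first column distinct, so this set
has at least `k` elements. Picking minimal elements one by one gives the left end.

The isomorphism. Given a left end, replace it inside each block by the smallest elements of the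
block, matching the usual order in which `S^ν V_[p]` is defined. The box product of the `S^{μ[p]}
V_[p]` embeds in the tensor power once the boxes are grouped by the block of their row;
antisymmetrizing along the full columns then gives an `𝔩(≺)`-map `blockToTensor`. It sends the
product of the highest weight vectors to a nonzero multiple of an extremal vector, which is
`𝔲(≺)`-invariant. As the box product is cyclic on that product (`blockTensor_eq_top`), the image
consists of invariants of `S^μ V`.

Injectivity: projecting each box to its own block commutes with `𝔩(≺)` and undoes the
antisymmetrization up to a nonzero factor on the cyclic generator, hence everywhere.

Surjectivity: by a triangular decomposition argument `S^μ V` is contained in the image plus the span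
of the images of the lowering operators `E b a`, `a ≺ b` (`schur_le_range_sup`). The basis of pure
tensors is orthonormal for a positive definite Hermitian form in which `E a b` and `E b a` are
adjoint. Hence an invariant vector that is a sum of lowered vectors is orthogonal to itself and
vanishes (`eq_zero_of_mem_span_der`), so every invariant lies in the image. -/

noncomputable section

attribute [local instance 100] LieRing.ofAssociativeRing

/-! ### Derivations of a tensor power and their exponentials -/

namespace TensorAction

section

variable {B : Type} [Fintype B] [DecidableEq B] {W : Type} [AddCommGroup W] [Module ℂ W]

/-- The derivation of the tensor power induced by an endomorphism of `W`. -/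
def der : Module.End ℂ W →ₗ[ℂ] Module.End ℂ (⨂[ℂ] _ : B, W) where
  toFun x := ∑ b, onFactor (M := fun _ : B => W) b x
  map_add' x y := by simp [onFactor_add, Finset.sum_add_distrib]
  map_smul' c x := by simp [onFactor_smul, Finset.smul_sum]

theorem der_apply (x : Module.End ℂ W) (z : ⨂[ℂ] _ : B, W) :
    der x z = ∑ b, onFactor (M := fun _ : B => W) b x z := by
  change (∑ b, onFactor (M := fun _ : B => W) b x) z = _
  rw [LinearMap.sum_apply]

theorem der_tprod (x : Module.End ℂ W) (t : B → W) :
    der x (PiTensorProduct.tprod ℂ t) =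
      ∑ b, PiTensorProduct.tprod ℂ (Function.update t b (x (t b))) := by
  rw [der_apply]
  exact Finset.sum_congr rfl fun b _ => onFactor_tprod (M := fun _ : B => W) b x t

theorem lie_eq_der {L : Type} [LieRing L] [LieAlgebra ℂ L] [LieRingModule L W] [LieModule ℂ L W]
    (x : L) (z : ⨂[ℂ] _ : B, W) : ⁅x, z⁆ = der (LieModule.toEnd ℂ L W x) z := by
  change leibniz (L := L) (M := fun _ : B => W) x z = _
  rw [der_apply]
  simp [leibniz, LinearMap.sum_apply]

omit [Fintype B] [DecidableEq B] in
theorem reindex_tprod_const (σ : Equiv.Perm B) (t : B → W) :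
    PiTensorProduct.reindex ℂ (fun _ => W) σ (PiTensorProduct.tprod ℂ t) =
      PiTensorProduct.tprod ℂ (fun c => t (σ.symm c)) :=
  PiTensorProduct.reindex_tprod σ t

omit [Fintype B] [DecidableEq B] in
theorem int_smul_eq (n : ℤ) (z : ⨂[ℂ] _ : B, W) : n • z = (n : ℂ) • z := by
  rw [← zsmul_one (R := ℂ) n, smul_assoc, one_smul]

theorem der_reindex (x : Module.End ℂ W) (σ : Equiv.Perm B) (z : ⨂[ℂ] _ : B, W) :
    der x (PiTensorProduct.reindex ℂ (fun _ => W) σ z) =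
      PiTensorProduct.reindex ℂ (fun _ => W) σ (der x z) := by
  have : (der x) ∘ₗ (PiTensorProduct.reindex ℂ (fun _ => W) σ).toLinearMap =
      (PiTensorProduct.reindex ℂ (fun _ => W) σ).toLinearMap ∘ₗ (der x) := by
    refine PiTensorProduct.ext (MultilinearMap.ext fun t => ?_)
    simp only [LinearMap.compMultilinearMap_apply, LinearMap.comp_apply, LinearEquiv.coe_coe,
      reindex_tprod_const, der_tprod, map_sum]
    refine Fintype.sum_equiv σ.symm _ _ fun b => ?_
    congr 1
    funext c
    by_cases h : c = b
    · subst h; simp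
    · simp [h]
  exact LinearMap.congr_fun this z

theorem map_der {W' : Type} [AddCommGroup W'] [Module ℂ W'] {f : B → W →ₗ[ℂ] W'}
    {x : Module.End ℂ W} {x' : Module.End ℂ W'} (h : ∀ c v, f c (x v) = x' (f c v))
    (z : ⨂[ℂ] _ : B, W) :
    PiTensorProduct.map f (der x z) = der x' (PiTensorProduct.map f z) := by
  have : (PiTensorProduct.map f) ∘ₗ (der x) = (der x') ∘ₗ (PiTensorProduct.map f) := by
    refine PiTensorProduct.ext (MultilinearMap.ext fun t => ?_)
    simp only [LinearMap.compMultilinearMap_apply, LinearMap.comp_apply, PiTensorProduct.map_tprod,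
      der_tprod, map_sum]
    refine Finset.sum_congr rfl fun b _ => ?_
    congr 1
    funext c
    by_cases h : c = b
    · subst h; simp [h]
    · simp [h]
  exact LinearMap.congr_fun this z

omit [Fintype B] in
theorem onFactor_one (b : B) : onFactor (M := fun _ : B => W) b 1 = 1 := by
  refine PiTensorProduct.ext (MultilinearMap.ext fun m => ?_)
  simp [onFactor_tprod]

/-- The operators `onFactor b f` commute and square to zero, so `der f` is nilpotent and its
exponential is the product of the `1 + onFactor b f`, that is, `1 + f` in every factor. The
exponential is a polynomial in `der f` and so preserves `Z`. This gives root subgroups inside the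
Lie algebra action. -/
theorem map_one_add_mem {f : Module.End ℂ W} (hf : f * f = 0) {Z : Submodule ℂ (⨂[ℂ] _ : B, W)}
    (hZ : ∀ z ∈ Z, der f z ∈ Z) {z : ⨂[ℂ] _ : B, W} (hz : z ∈ Z) :
    PiTensorProduct.map (fun _ => 1 + f) z ∈ Z := by
  -- `IsNilpotent.exp` has rational coefficients, while `Z` is only a complex subspace.
  have hsm : ∀ (q : ℚ) (y : ⨂[ℂ] _ : B, W), q • y = (q • (1 : ℂ)) • y := fun q y => by
    rw [smul_assoc, one_smul]
  have hsq : ∀ b : B, (onFactor (M := fun _ : B => W) b f) ^ 2 = 0 := fun b => by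
    rw [pow_two, onFactor_mul, hf, ← zero_smul ℂ (0 : Module.End ℂ W), onFactor_smul, zero_smul]
  have hcomm : ∀ b c : B, Commute (onFactor (M := fun _ : B => W) b f)
      (onFactor (M := fun _ : B => W) c f) := by
    intro b c
    by_cases h : b = c
    · subst h; exact Commute.refl _
    · exact onFactor_commute (M := fun _ : B => W) h f f
  have hexp : ∀ b : B, IsNilpotent.exp (onFactor (M := fun _ : B => W) b f)
      = onFactor (M := fun _ : B => W) b (1 + f) := fun b => by
    rw [IsNilpotent.exp_eq_sum (hsq b), onFactor_add, onFactor_one]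
    simp [Finset.sum_range_succ]
  have key : ∀ S : Finset B, IsNilpotent (∑ b ∈ S, onFactor (M := fun _ : B => W) b f) ∧
      IsNilpotent.exp (∑ b ∈ S, onFactor (M := fun _ : B => W) b f) =
        PiTensorProduct.map (fun c => if c ∈ S then 1 + f else 1) := by
    intro S
    induction S using Finset.induction_on with
    | empty =>
      refine ⟨by simp, ?_⟩
      simp [IsNilpotent.exp_zero]
    | insert b S hb ih =>
      rw [Finset.sum_insert hb]
      have hc : Commute (onFactor (M := fun _ : B => W) b f)
          (∑ b ∈ S, onFactor (M := fun _ : B => W) b f) :=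
        Commute.sum_right _ _ _ fun c _ => hcomm b c
      refine ⟨hc.isNilpotent_add ⟨2, hsq b⟩ ih.1, ?_⟩
      rw [IsNilpotent.exp_add_of_commute hc ⟨2, hsq b⟩ ih.1, ih.2, hexp]
      unfold onFactor
      rw [← PiTensorProduct.map_mul]
      congr 1
      funext c
      by_cases h : c = b
      · subst h; simp [hb]
      · simp [h]
        rfl
  have h1 : PiTensorProduct.map (fun _ : B => 1 + f) = IsNilpotent.exp (der (B := B) f) := by
    have := (key Finset.univ).2
    simp only [Finset.mem_univ, if_true] at this
    exact this.symm
  obtain ⟨n, hn⟩ : IsNilpotent (der (B := B) f) := (key Finset.univ).1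
  rw [h1, IsNilpotent.exp_eq_sum hn, LinearMap.sum_apply]
  refine Z.sum_mem fun k hk => ?_
  rw [LinearMap.smul_apply, hsm]
  refine Z.smul_mem _ ?_
  clear hn hk
  induction k with
  | zero => simpa using hz
  | succ k ih => rw [pow_succ']; exact hZ _ ih

/-! ### Antisymmetrization along columns -/

/-- The antisymmetrization of a pure tensor along the fibres of `col`. -/
def colAlt (col : B → ℕ) (t : B → W) : ⨂[ℂ] _ : B, W :=
  ∑ σ : Equiv.Perm B with ∀ c, col (σ c) = col c,
    ((Equiv.Perm.sign σ : ℤ) : ℂ) • PiTensorProduct.tprod ℂ fun c => t (σ c)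

variable (col : B → ℕ)

theorem colAlt_comp_perm (t : B → W) (τ : Equiv.Perm B) (hτ : ∀ c, col (τ c) = col c) :
    colAlt col (fun c => t (τ c)) = ((Equiv.Perm.sign τ : ℤ) : ℂ) • colAlt col t := by
  unfold colAlt
  rw [Finset.smul_sum]
  refine Finset.sum_bij' (fun σ _ => τ * σ) (fun σ _ => τ⁻¹ * σ) ?_ ?_ ?_ ?_ ?_
  · intro σ hσ
    simp only [Finset.mem_filter, Finset.mem_univ, true_and] at hσ ⊢
    intro c; rw [Equiv.Perm.mul_apply, hτ, hσ]
  · intro σ hσ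
    simp only [Finset.mem_filter, Finset.mem_univ, true_and] at hσ ⊢
    intro c; rw [← hτ, ← Equiv.Perm.mul_apply, mul_inv_cancel_left, hσ]
  · intro σ _; simp
  · intro σ _; simp
  · intro σ _
    rw [smul_smul]
    rw [Equiv.Perm.sign_mul]
    congr 1
    rw [← Int.cast_mul, ← Units.val_mul, ← mul_assoc, Int.units_mul_self, one_mul]

/-- Swapping the two equal entries fixes `t` but changes the sign, and 2 is invertible. -/
theorem colAlt_eq_zero {t : B → W} {c d : B} (hcd : c ≠ d) (hcol : col c = col d)
    (ht : t c = t d) : colAlt col t = 0 := by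
  have h := colAlt_comp_perm col t (Equiv.swap c d) (fun b => by
    by_cases h1 : b = c
    · subst h1; simp [hcol]
    · by_cases h2 : b = d
      · subst h2; simp [hcol]
      · rw [Equiv.swap_apply_of_ne_of_ne h1 h2])
  have h' : (fun b => t (Equiv.swap c d b)) = t := by
    funext b
    by_cases h1 : b = c
    · subst h1; simp [ht]
    · by_cases h2 : b = d
      · subst h2; simp [ht]
      · rw [Equiv.swap_apply_of_ne_of_ne h1 h2]
  rw [h', Equiv.Perm.sign_swap hcd] at h
  simp only [Units.val_neg, Units.val_one, Int.cast_neg, Int.cast_one, neg_smul, one_smul] at h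
  have h2 : (2 : ℂ) • colAlt col t = 0 := by
    rw [two_smul]; nth_rewrite 1 [h]; simp
  exact (smul_eq_zero.1 h2).resolve_left two_ne_zero

theorem colAlt_eq_zero_of_apply_eq_zero {t : B → W} {c : B} (ht : t c = 0) :
    colAlt col t = 0 := by
  unfold colAlt
  refine Finset.sum_eq_zero fun σ _ => ?_
  rw [MultilinearMap.map_coord_zero _ (σ.symm c) (by simpa using ht), smul_zero]

theorem colAlt_update_smul (t : B → W) (c : B) (k : ℂ) (v : W) :
    colAlt col (Function.update t c (k • v)) = k • colAlt col (Function.update t c v) := by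
  unfold colAlt
  rw [Finset.smul_sum]
  refine Finset.sum_congr rfl fun σ _ => ?_
  have h : ∀ u : W, (fun d => Function.update t c u (σ d)) =
      Function.update (fun d => t (σ d)) (σ.symm c) u := fun u => by
    funext d
    by_cases hd : σ d = c
    · subst hd; simp
    · rw [Function.update_of_ne hd, Function.update_of_ne]
      rintro rfl
      exact hd (σ.apply_symm_apply c)
  rw [h, h, MultilinearMap.map_update_smul, smul_comm]

theorem der_colAlt (x : Module.End ℂ W) (t : B → W) :
    der x (colAlt col t) = ∑ c, colAlt col (Function.update t c (x (t c))) := by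
  unfold colAlt
  rw [map_sum, Finset.sum_comm]
  refine Finset.sum_congr rfl fun σ _ => ?_
  rw [map_smul, der_tprod, ← Finset.smul_sum]
  congr 1
  refine Fintype.sum_equiv σ _ _ fun b => ?_
  congr 1
  funext c
  by_cases h : c = b
  · subst h; simp
  · simp [h]

/-- Applied to Cartan elements: weight vectors in the boxes give a weight vector of the sum of the
weights. -/
theorem der_colAlt_of_eigen {x : Module.End ℂ W} {t : B → W} {κ : B → ℂ}
    (h : ∀ c, x (t c) = κ c • t c) : der x (colAlt col t) = (∑ c, κ c) • colAlt col t := by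
  rw [der_colAlt, Finset.sum_smul]
  refine Finset.sum_congr rfl fun c _ => ?_
  rw [h, colAlt_update_smul, Function.update_eq_self]

theorem map_colAlt {W' : Type} [AddCommGroup W'] [Module ℂ W'] (f : W →ₗ[ℂ] W') (t : B → W) :
    PiTensorProduct.map (fun _ => f) (colAlt col t) = colAlt col (fun c => f (t c)) := by
  unfold colAlt
  rw [map_sum]
  refine Finset.sum_congr rfl fun σ _ => ?_
  rw [map_smul, PiTensorProduct.map_tprod]

/-- Antisymmetrization along the fibres of `col`. -/
def colAltMap : Module.End ℂ (⨂[ℂ] _ : B, W) :=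
  ∑ σ : Equiv.Perm B with ∀ c, col (σ c) = col c,
    ((Equiv.Perm.sign σ : ℤ) : ℂ) • (PiTensorProduct.reindex ℂ (fun _ => W) σ.symm).toLinearMap

theorem colAltMap_tprod (t : B → W) :
    colAltMap col (PiTensorProduct.tprod ℂ t) = colAlt col t := by
  unfold colAltMap colAlt
  rw [LinearMap.sum_apply]
  refine Finset.sum_congr rfl fun σ _ => ?_
  rw [LinearMap.smul_apply, LinearEquiv.coe_coe, reindex_tprod_const]
  rfl

theorem colAltMap_der (x : Module.End ℂ W) (z : ⨂[ℂ] _ : B, W) :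
    colAltMap col (der x z) = der x (colAltMap col z) := by
  unfold colAltMap
  rw [LinearMap.sum_apply, LinearMap.sum_apply, map_sum]
  refine Finset.sum_congr rfl fun σ _ => ?_
  rw [LinearMap.smul_apply, LinearMap.smul_apply, map_smul, LinearEquiv.coe_coe, der_reindex]

end

end TensorAction

open TensorAction

namespace SlInf

/-! ### Linear spanning sets -/

theorem E_apply_e (i j m : ℕ) : E i j (e m) = if m = j then e i else 0 := by
  rw [E_apply, coord_e]
  split_ifs <;> simp

/-- Root vectors for the relation `r`, and the elements `E i i - E j j`. -/
def gens (r : ℕ → ℕ → Prop) : Set (Module.End ℂ V) :=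
  {x | ∃ i j, i ≠ j ∧ r i j ∧ x = E i j} ∪ {x | ∃ i j, x = E i i - E j j}

theorem E_mem_span_gens {r : ℕ → ℕ → Prop} {i j : ℕ} (hij : i ≠ j) (h : r i j) :
    E i j ∈ Submodule.span ℂ (gens r) :=
  Submodule.subset_span (Or.inl ⟨i, j, hij, h, rfl⟩)

theorem sub_mem_span_gens (r : ℕ → ℕ → Prop) (i j : ℕ) :
    E i i - E j j ∈ Submodule.span ℂ (gens r) :=
  Submodule.subset_span (Or.inr ⟨i, j, rfl⟩)

theorem diag_lie_E (a i j : ℕ) :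
    ⁅E a a, E i j⁆ = ((if i = a then (1 : ℂ) else 0) - if a = j then 1 else 0) • E i j := by
  rw [E_lie_E, sub_smul]
  split_ifs <;> subst_vars <;> simp

theorem diag_lie_diag (a i : ℕ) : ⁅E a a, E i i⁆ = 0 := by
  rw [diag_lie_E]
  by_cases h : i = a
  · subst h; simp
  · rw [if_neg h, if_neg (Ne.symm h)]; simp

/-- Transitivity of `r` is what closes the span under brackets: `[E a b, E b d] = E a d`, and for `d
= a` a difference of diagonal units appears. It is used for the full relation, giving `𝔰𝔩(∞)`, and
for the same-block relation, giving `𝔩(≺)`. -/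
theorem lie_mem_span_gens {r : ℕ → ℕ → Prop} (hr : ∀ i j m, r i j → r j m → r i m)
    {x y : Module.End ℂ V} (hx : x ∈ Submodule.span ℂ (gens r))
    (hy : y ∈ Submodule.span ℂ (gens r)) : ⁅x, y⁆ ∈ Submodule.span ℂ (gens r) := by
  induction hx, hy using Submodule.span_induction₂ with
  | mem_mem x y hx hy =>
    rcases hx with ⟨a, b, hab, hrab, rfl⟩ | ⟨a, b, rfl⟩ <;>
      rcases hy with ⟨c, d, hcd, hrcd, rfl⟩ | ⟨c, d, rfl⟩
    · rw [E_lie_E]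
      by_cases h1 : c = b
      · by_cases h2 : a = d
        · subst h1 h2; simpa using sub_mem_span_gens r a c
        · subst h1
          rw [if_pos rfl, if_neg h2, sub_zero]
          exact E_mem_span_gens h2 (hr _ _ _ hrab hrcd)
      · by_cases h2 : a = d
        · subst h2
          rw [if_pos rfl, if_neg h1, zero_sub]
          exact Submodule.neg_mem _ (E_mem_span_gens h1 (hr _ _ _ hrcd hrab))
        · simp [h1, h2]
    · rw [← lie_skew, sub_lie, diag_lie_E, diag_lie_E, ← sub_smul]
      exact Submodule.neg_mem _ (Submodule.smul_mem _ _ (E_mem_span_gens hab hrab))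
    · rw [sub_lie, diag_lie_E, diag_lie_E, ← sub_smul]
      exact Submodule.smul_mem _ _ (E_mem_span_gens hcd hrcd)
    · simp only [sub_lie, lie_sub, diag_lie_diag]
      simp
  | zero_left y hy => simp
  | zero_right x hx => simp
  | add_left x y z _ _ _ h1 h2 => rw [add_lie]; exact Submodule.add_mem _ h1 h2
  | add_right x y z _ _ _ h1 h2 => rw [lie_add]; exact Submodule.add_mem _ h1 h2
  | smul_left c x y _ _ h => rw [smul_lie]; exact Submodule.smul_mem _ _ h
  | smul_right c x y _ _ h => rw [lie_smul]; exact Submodule.smul_mem _ _ h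

theorem mem_span_gens_of_mem_sl {x : Module.End ℂ V} (hx : x ∈ sl) :
    x ∈ Submodule.span ℂ (gens fun _ _ => True) := by
  let K : LieSubalgebra ℂ (Module.End ℂ V) :=
    { Submodule.span ℂ (gens fun _ _ => True) with
      lie_mem' := fun hx hy => lie_mem_span_gens (fun _ _ _ _ _ => trivial) hx hy }
  have : sl ≤ K := LieSubalgebra.lieSpan_le.2 (by
    rintro _ ⟨i, j, hij, rfl⟩
    exact E_mem_span_gens hij trivial)
  exact this hx

/-- The root vector `E i j` as an element of `𝔰𝔩(∞)`. -/
def rootVector {i j : ℕ} (h : i ≠ j) : sl := ⟨E i j, LieSubalgebra.subset_lieSpan ⟨i, j, h, rfl⟩⟩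

theorem coe_rootVector {i j : ℕ} (h : i ≠ j) : (rootVector h : Module.End ℂ V) = E i j := rfl

/-- A subspace of a Lie module generated from `N` by a set `Y` of operators is stable as soon as
the whole Lie algebra maps `N` into it. -/
theorem lie_mem_of_closure {L M : Type} [LieRing L] [LieAlgebra ℂ L] [AddCommGroup M] [Module ℂ M]
    [LieRingModule L M] [LieModule ℂ L M] (Y : Set L) (N C : Submodule ℂ M)
    (hmin : ∀ Z : Submodule ℂ M, N ≤ Z → (∀ y ∈ Y, ∀ z ∈ Z, ⁅y, z⁆ ∈ Z) → C ≤ Z)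
    (hNC : N ≤ C) (hY : ∀ y ∈ Y, ∀ z ∈ C, ⁅y, z⁆ ∈ C) (hN : ∀ x : L, ∀ n ∈ N, ⁅x, n⁆ ∈ C)
    (x : L) {m : M} (hm : m ∈ C) : ⁅x, m⁆ ∈ C := by
  let Z : Submodule ℂ M :=
    { carrier := {m | m ∈ C ∧ ∀ x : L, ⁅x, m⁆ ∈ C}
      add_mem' := fun {a b} ha hb => ⟨C.add_mem ha.1 hb.1, fun x => by
        rw [lie_add]; exact C.add_mem (ha.2 x) (hb.2 x)⟩
      zero_mem' := ⟨C.zero_mem, fun x => by rw [lie_zero]; exact C.zero_mem⟩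
      smul_mem' := fun c a ha => ⟨C.smul_mem c ha.1, fun x => by
        rw [lie_smul]; exact C.smul_mem c (ha.2 x)⟩ }
  -- Here `x y z = [x, y] z + y x z`. Since `Z` asks for all `x` at once, the term with `[x, y]` is
  -- covered too, and no ordering of monomials in an enveloping algebra is needed.
  have hZ : C ≤ Z := hmin Z (fun n hn => ⟨hNC hn, fun x => hN x n hn⟩) fun y hy z hz =>
    ⟨hY y hy z hz.1, fun x => by
      rw [leibniz_lie]
      exact C.add_mem (hz.2 _) (hY y hy _ (hz.2 x))⟩
  exact (hZ hm).2 x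

/-! ### Coordinates in tensor powers of `V` -/

section

variable {B : Type} [Fintype B] [DecidableEq B]

/-- The basis of pure tensors of basis vectors. -/
def tensorBasis (B : Type) [Fintype B] : Module.Basis (B → ℕ) ℂ (⨂[ℂ] _ : B, V) :=
  Basis.piTensorProduct fun _ => e

omit [DecidableEq B] in
theorem tensorBasis_apply (f : B → ℕ) :
    tensorBasis B f = PiTensorProduct.tprod ℂ fun c => e (f c) :=
  Basis.piTensorProduct_apply _ _

theorem der_E_tensorBasis (a b : ℕ) (f : B → ℕ) :
    der (E a b) (tensorBasis B f) =
      ∑ c, if f c = b then tensorBasis B (Function.update f c a) else 0 := by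
  rw [tensorBasis_apply, der_tprod]
  refine Finset.sum_congr rfl fun c _ => ?_
  rw [E_apply_e]
  split_ifs with h
  · rw [tensorBasis_apply]
    congr 1
    funext d
    by_cases hd : d = c
    · subst hd; simp
    · simp [hd]
  · exact MultilinearMap.map_coord_zero _ c (by simp)

/-- The transpose of `der_E_tensorBasis`: a basis tensor contributes to the coordinate at `f`
exactly when it arises from `f` by changing one entry `a` back to `b`. -/
theorem repr_der_E (a b : ℕ) (z : ⨂[ℂ] _ : B, V) (f : B → ℕ) :
    (tensorBasis B).repr (der (E a b) z) f =
      ∑ c, if f c = a then (tensorBasis B).repr z (Function.update f c b) else 0 := by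
  let F : (⨂[ℂ] _ : B, V) →ₗ[ℂ] ℂ := (tensorBasis B).coord f ∘ₗ der (E a b)
  let G : (⨂[ℂ] _ : B, V) →ₗ[ℂ] ℂ :=
    ∑ c, if f c = a then (tensorBasis B).coord (Function.update f c b) else 0
  have hG : ∀ z, G z = ∑ c, if f c = a then
      (tensorBasis B).repr z (Function.update f c b) else 0 := fun z => by
    simp only [G, LinearMap.sum_apply]
    refine Finset.sum_congr rfl fun c _ => ?_
    split_ifs <;> simp
  have hFG : F = G := by
    refine (tensorBasis B).ext fun g => ?_
    rw [hG]
    simp only [F, LinearMap.comp_apply, der_E_tensorBasis, map_sum, Module.Basis.coord_apply]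
    refine Finset.sum_congr rfl fun c _ => ?_
    have hiff : (g c = b ∧ Function.update g c a = f) ↔ (f c = a ∧ g = Function.update f c b) := by
      constructor
      · rintro ⟨h1, h2⟩
        subst h2
        simp [← h1]
      · rintro ⟨h1, h2⟩
        subst h2
        simp [← h1]
    by_cases h1 : g c = b <;> by_cases h2 : f c = a <;>
      simp only [h1, h2, if_true, if_false, map_zero, Finsupp.zero_apply,
        Module.Basis.repr_self, Finsupp.single_apply, true_and, false_and, false_iff, iff_false]
        at hiff ⊢
    · simp only [hiff]
    · simp [hiff]
    · simp [hiff]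
  have := LinearMap.congr_fun hFG z
  rw [hG] at this
  exact this

/-- Complex conjugation of coordinates. -/
def conjCoord (z : ⨂[ℂ] _ : B, V) : ⨂[ℂ] _ : B, V :=
  (tensorBasis B).repr.symm (((tensorBasis B).repr z).mapRange (starRingEnd ℂ) (map_zero _))

omit [DecidableEq B] in
theorem repr_conjCoord (z : ⨂[ℂ] _ : B, V) (f : B → ℕ) :
    (tensorBasis B).repr (conjCoord z) f = starRingEnd ℂ ((tensorBasis B).repr z f) := by
  simp [conjCoord]

/-- Matrix units have real entries. -/
theorem der_E_conjCoord (a b : ℕ) (z : ⨂[ℂ] _ : B, V) :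
    der (E a b) (conjCoord z) = conjCoord (der (E a b) z) := by
  refine (tensorBasis B).ext_elem fun f => ?_
  rw [repr_der_E, repr_conjCoord, repr_der_E, map_sum]
  refine Finset.sum_congr rfl fun c _ => ?_
  split_ifs
  · rw [repr_conjCoord]
  · rw [map_zero]

/-- The bilinear form for which the basis of pure tensors is orthonormal. -/
def dotForm (B : Type) [Fintype B] :
    (⨂[ℂ] _ : B, V) →ₗ[ℂ] (⨂[ℂ] _ : B, V) →ₗ[ℂ] ℂ :=
  (tensorBasis B).constr ℂ fun f => (tensorBasis B).coord f

omit [DecidableEq B] in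
theorem dotForm_tensorBasis (f : B → ℕ) (z : ⨂[ℂ] _ : B, V) :
    dotForm B (tensorBasis B f) z = (tensorBasis B).repr z f := by
  simp [dotForm, Module.Basis.constr_basis]

/-- Contravariance: for an orthonormal basis the adjoint of a matrix unit is its transpose. -/
theorem dotForm_der_E (a b : ℕ) (y z : ⨂[ℂ] _ : B, V) :
    dotForm B (der (E a b) y) z = dotForm B y (der (E b a) z) := by
  have : (dotForm B).flip z ∘ₗ der (E a b) = (dotForm B).flip (der (E b a) z) := by
    refine (tensorBasis B).ext fun f => ?_
    simp only [LinearMap.comp_apply, LinearMap.flip_apply]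
    rw [dotForm_tensorBasis, repr_der_E, der_E_tensorBasis, map_sum, LinearMap.sum_apply]
    refine Finset.sum_congr rfl fun c _ => ?_
    split_ifs
    · rw [dotForm_tensorBasis]
    · simp
  exact LinearMap.congr_fun this y

-- The bilinear form alone has isotropic vectors; with one argument conjugated it becomes the sum of
-- the squared absolute values of the coordinates.
omit [DecidableEq B] in
theorem eq_zero_of_dotForm_conjCoord {z : ⨂[ℂ] _ : B, V} (h : dotForm B (conjCoord z) z = 0) :
    z = 0 := by
  have h1 : dotForm B (conjCoord z) z =
      ((∑ f ∈ ((tensorBasis B).repr z).support,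
        Complex.normSq ((tensorBasis B).repr z f) : ℝ) : ℂ) := by
    rw [dotForm, Module.Basis.constr_apply, Finsupp.sum]
    rw [LinearMap.sum_apply]
    have hs : ((tensorBasis B).repr (conjCoord z)).support ⊆ ((tensorBasis B).repr z).support := by
      intro f hf
      rw [Finsupp.mem_support_iff, repr_conjCoord] at hf
      rw [Finsupp.mem_support_iff]
      intro h0
      exact hf (by rw [h0, map_zero])
    rw [Finset.sum_subset hs, Complex.ofReal_sum]
    · refine Finset.sum_congr rfl fun f _ => ?_
      rw [repr_conjCoord, LinearMap.smul_apply, Module.Basis.coord_apply, smul_eq_mul,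
        mul_comm, Complex.mul_conj]
    · intro f _ hf
      rw [Finsupp.notMem_support_iff.1 hf, zero_smul, LinearMap.zero_apply]
  rw [h1, Complex.ofReal_eq_zero, Finset.sum_eq_zero_iff_of_nonneg
    fun f _ => Complex.normSq_nonneg _] at h
  refine (tensorBasis B).ext_elem fun f => ?_
  rw [map_zero, Finsupp.zero_apply]
  by_contra hf
  exact hf (Complex.normSq_eq_zero.1 (h f (Finsupp.mem_support_iff.2 hf)))

/-- A vector killed by root vectors that is a sum of images of the opposite root vectors is `0`. -/
theorem eq_zero_of_mem_span_der {r : ℕ → ℕ → Prop} {z : ⨂[ℂ] _ : B, V}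
    (h0 : ∀ a b, r a b → der (E a b) z = 0)
    (hz : z ∈ Submodule.span ℂ {y | ∃ a b, r a b ∧ ∃ m : ⨂[ℂ] _ : B, V, y = der (E b a) m}) :
    z = 0 := by
  -- Pairing the conjugate of `z` with `E b a m` moves `E b a` across as `E a b`, which kills the
  -- conjugate. So the conjugate of `z` annihilates the whole span, including `z`.
  have key : Submodule.span ℂ {y | ∃ a b, r a b ∧ ∃ m : ⨂[ℂ] _ : B, V, y = der (E b a) m} ≤
      LinearMap.ker (dotForm B (conjCoord z)) := by
    rw [Submodule.span_le]
    rintro _ ⟨a, b, hab, m, rfl⟩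
    rw [SetLike.mem_coe, LinearMap.mem_ker, ← dotForm_der_E, der_E_conjCoord, h0 a b hab]
    have : conjCoord (0 : ⨂[ℂ] _ : B, V) = 0 := by simp [conjCoord]
    rw [this, map_zero, LinearMap.zero_apply]
  exact eq_zero_of_dotForm_conjCoord (key hz)

end

end SlInf

open TensorAction

namespace SlInf

/-! ### Extremal vectors -/

/-- The column of a box. -/
def boxCol (ν : List ℕ) (c : Box ν) : ℕ := c.2

theorem highestWeightVector_eq {W : Type} [AddCommGroup W] [Module ℂ W] (b : ℕ → W) (ν : List ℕ) :
    highestWeightVector b ν = colAlt (boxCol ν) fun c => b c.1 :=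
  Finset.sum_congr rfl fun _ _ => int_smul_eq _ _

/-- The vector that puts `e (i r)` into every box of row `r`, antisymmetrized along columns. -/
def extremal (ν : List ℕ) (i : Fin ν.length → ℕ) : ⨂[ℂ] _ : Box ν, V :=
  colAlt (boxCol ν) fun c => e (i c.1)

theorem highestWeightVector_e (ν : List ℕ) :
    highestWeightVector e ν = extremal ν fun r => r :=
  highestWeightVector_eq _ _

section

variable {L : Type} [LieRing L] [LieAlgebra ℂ L] {W : Type} [AddCommGroup W] [Module ℂ W]
  [LieRingModule L W] [LieModule ℂ L W] (b : ℕ → W) (ν : List ℕ)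

theorem schur_le {Z : Submodule ℂ (⨂[ℂ] _ : Box ν, W)} (h : highestWeightVector b ν ∈ Z)
    (hZ : ∀ (x : L), ∀ z ∈ Z, der (LieModule.toEnd ℂ L W x) z ∈ Z) :
    (schur L b ν).toSubmodule ≤ Z := by
  let Z' : LieSubmodule ℂ L (⨂[ℂ] _ : Box ν, W) :=
    { Z with lie_mem := fun {x m} hm => by rw [lie_eq_der]; exact hZ x m hm }
  have : schur L b ν ≤ Z' := LieSubmodule.lieSpan_le.2 (by rintro _ rfl; exact h)
  exact this

theorem highestWeightVector_mem_schur : highestWeightVector b ν ∈ schur L b ν :=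
  LieSubmodule.subset_lieSpan rfl

theorem der_mem_schur (x : L) {z : ⨂[ℂ] _ : Box ν, W} (hz : z ∈ schur L b ν) :
    der (LieModule.toEnd ℂ L W x) z ∈ schur L b ν := by
  rw [← lie_eq_der]
  exact LieSubmodule.lie_mem _ hz

end

section

variable {ν : List ℕ} {Z : Submodule ℂ (⨂[ℂ] _ : Box ν, V)}

/-- The product `(1 - E (i s) b) (1 + E b (i s))` of two root subgroup elements sends `e (i s)` to
`e b` and fixes the other `e (i r)`. Both factors preserve `Z` by `map_one_add_mem`. -/
theorem extremal_update_mem (hZ : ∀ (x : sl), ∀ z ∈ Z, der (x : Module.End ℂ V) z ∈ Z)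
    {i : Fin ν.length → ℕ}
    (hi : Function.Injective i) (s : Fin ν.length) {b : ℕ} (hb : ∀ r, i r ≠ b)
    (h : extremal ν i ∈ Z) : extremal ν (Function.update i s b) ∈ Z := by
  have hE : ∀ {a b : ℕ} (hab : a ≠ b) (c : ℂ), ∀ z ∈ Z, der (c • E a b) z ∈ Z := by
    intro a b hab c z hz
    rw [map_smul, LinearMap.smul_apply]
    exact Z.smul_mem _ (hZ (rootVector hab) z hz)
  have hsq : ∀ {a b : ℕ} (_ : a ≠ b) (c : ℂ), (c • E a b) * (c • E a b) = 0 := by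
    intro a b hab c
    rw [smul_mul_smul_comm, E_mul_E, if_neg hab, smul_zero]
  have h1 := map_one_add_mem (hsq (hb s).symm 1) (hE (hb s).symm 1) h
  have h2 := map_one_add_mem (hsq (hb s) (-1)) (hE (hb s) (-1)) h1
  have : PiTensorProduct.map (fun _ : Box ν => 1 + (-1 : ℂ) • E (i s) b)
      (PiTensorProduct.map (fun _ : Box ν => 1 + (1 : ℂ) • E b (i s)) (extremal ν i)) =
      extremal ν (Function.update i s b) := by
    unfold extremal
    rw [map_colAlt, map_colAlt]
    congr 1
    funext c
    by_cases hc : c.1 = s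
    · simp only [hc, one_smul, neg_smul, LinearMap.add_apply, Module.End.one_apply, E_apply_e,
        LinearMap.neg_apply, map_add, if_true, if_neg (hb s), Function.update_self]
      abel
    · have h1 : i c.1 ≠ i s := fun h => hc (hi h)
      simp [hc, E_apply_e, h1, hb c.1]
  rwa [this] at h2

/-- Rows are moved one at a time; disjointness keeps the next target index unoccupied. -/
theorem extremal_mem_of_disjoint (hZ : ∀ (x : sl), ∀ z ∈ Z, der (x : Module.End ℂ V) z ∈ Z)
    {i i' : Fin ν.length → ℕ}
    (hi : Function.Injective i) (hi' : Function.Injective i') (hd : ∀ s t, i s ≠ i' t)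
    (h : extremal ν i ∈ Z) : extremal ν i' ∈ Z := by
  have key : ∀ S : Finset (Fin ν.length),
      extremal ν (fun s => if s ∈ S then i' s else i s) ∈ Z := by
    intro S
    induction S using Finset.induction_on with
    | empty => simpa using h
    | insert s S hs ih =>
      have h1 := extremal_update_mem (b := i' s) hZ (i := fun s => if s ∈ S then i' s else i s)
        (by
          intro r t hrt
          dsimp only at hrt
          split_ifs at hrt
          · exact hi' hrt
          · exact absurd hrt.symm (hd _ _)
          · exact absurd hrt (hd _ _)
          · exact hi hrt) s
        (by
          intro r
          split_ifs with hr
          · intro hrs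
            exact hs (hi' hrs ▸ hr)
          · exact hd _ _) ih
      convert h1 using 2
      funext r
      by_cases hr : r = s
      · subst hr; simp
      · simp [hr]
  simpa using key Finset.univ

theorem extremal_mem (hZ : ∀ (x : sl), ∀ z ∈ Z, der (x : Module.End ℂ V) z ∈ Z)
    {i i' : Fin ν.length → ℕ}
    (hi : Function.Injective i) (hi' : Function.Injective i') (h : extremal ν i ∈ Z) :
    extremal ν i' ∈ Z := by
  -- The ranges of `i` and `i'` may overlap, so the passage goes through fresh indices above both.
  let N := ∑ s, (i s + i' s) + 1
  have hlt : ∀ s, i s + i' s < N := fun s =>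
    Nat.lt_succ_of_le (Finset.single_le_sum (f := fun s => i s + i' s)
      (fun _ _ => Nat.zero_le _) (Finset.mem_univ s))
  have hF : Function.Injective fun s : Fin ν.length => N + (s : ℕ) := fun s t h =>
    Fin.ext (Nat.add_left_cancel h)
  refine extremal_mem_of_disjoint hZ hF hi' (fun s t => ?_)
    (extremal_mem_of_disjoint hZ hi hF (fun s t => ?_) h)
  · have := hlt t; omega
  · have := hlt s; omega

/-- `extremal ν i` is killed by `E a b` if `a` comes before `b` in `i` whenever `b` occurs. -/
theorem der_E_extremal_eq_zero (hν : ν.Pairwise (· ≥ ·)) {i : Fin ν.length → ℕ} {a b : ℕ}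
    (h : ∀ s, i s = b → ∃ t < s, i t = a) : der (E a b) (extremal ν i) = 0 := by
  unfold extremal
  rw [der_colAlt]
  refine Finset.sum_eq_zero fun c _ => ?_
  rw [E_apply_e]
  by_cases hc : i c.1 = b
  · obtain ⟨t, ht, hta⟩ := h c.1 hc
    rw [if_pos hc]
    -- `E a b` turns an entry `b` of row `s` into `a`. Row `t` lies above and is at least as long,
    -- so the same column already contains `a` and the antisymmetrization vanishes.
    have hle : ν.get c.1 ≤ ν.get t := List.pairwise_iff_get.1 hν t c.1 ht
    let d : Box ν := ⟨t, ⟨c.2, lt_of_lt_of_le c.2.2 hle⟩⟩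
    have hdc : d ≠ c := fun h => ht.ne (congrArg Sigma.fst h)
    refine colAlt_eq_zero (boxCol ν) (c := c) (d := d) hdc.symm rfl ?_
    rw [Function.update_self, Function.update_of_ne hdc, ← hta]
  · rw [if_neg hc]
    exact colAlt_eq_zero_of_apply_eq_zero _ (c := c) (by simp)

end

/-! ### Coordinates of vectors in `S^μ V` -/

theorem repr_reindex {B : Type} [Fintype B] [DecidableEq B] (σ : Equiv.Perm B)
    (z : ⨂[ℂ] _ : B, V) (f : B → ℕ) :
    (tensorBasis B).repr (PiTensorProduct.reindex ℂ (fun _ => V) σ z) f =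
      (tensorBasis B).repr z fun c => f (σ c) := by
  have : (tensorBasis B).coord f ∘ₗ (PiTensorProduct.reindex ℂ (fun _ => V) σ).toLinearMap =
      (tensorBasis B).coord fun c => f (σ c) := by
    refine (tensorBasis B).ext fun g => ?_
    have h : PiTensorProduct.reindex ℂ (fun _ => V) σ (tensorBasis B g) =
        tensorBasis B fun c => g (σ.symm c) := by
      rw [tensorBasis_apply, tensorBasis_apply]
      exact reindex_tprod_const σ _
    rw [LinearMap.comp_apply, LinearEquiv.coe_coe, h, Module.Basis.coord_apply,
      Module.Basis.coord_apply, Module.Basis.repr_self, Module.Basis.repr_self,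
      Finsupp.single_apply, Finsupp.single_apply]
    have hiff : ((fun c => g (σ.symm c)) = f) ↔ (g = fun c => f (σ c)) := by
      constructor
      · rintro rfl; simp
      · rintro rfl; simp
    simp only [hiff]
  exact LinearMap.congr_fun this z

theorem reindex_colAlt {B : Type} [Fintype B] [DecidableEq B] {W : Type} [AddCommGroup W]
    [Module ℂ W] (col : B → ℕ) (t : B → W) (τ : Equiv.Perm B) (hτ : ∀ c, col (τ c) = col c) :
    PiTensorProduct.reindex ℂ (fun _ => W) τ (colAlt col t) =
      ((Equiv.Perm.sign τ : ℤ) : ℂ) • colAlt col t := by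
  unfold colAlt
  rw [map_sum, Finset.smul_sum]
  have hτ' : ∀ c, col (τ.symm c) = col c := fun c => by
    rw [← hτ (τ.symm c), Equiv.apply_symm_apply]
  refine Finset.sum_bij' (fun σ _ => σ * τ⁻¹) (fun σ _ => σ * τ) ?_ ?_ ?_ ?_ ?_
  · intro σ hσ
    simp only [Finset.mem_filter, Finset.mem_univ, true_and] at hσ ⊢
    intro c
    rw [Equiv.Perm.mul_apply, hσ]
    exact hτ' c
  · intro σ hσ
    simp only [Finset.mem_filter, Finset.mem_univ, true_and] at hσ ⊢
    intro c; rw [Equiv.Perm.mul_apply, hσ, hτ]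
  · intro σ _; simp
  · intro σ _; simp
  · intro σ _
    rw [map_smul, reindex_tprod_const, smul_smul, Equiv.Perm.sign_mul, Equiv.Perm.sign_inv]
    congr 1
    rw [← Int.cast_mul, ← Units.val_mul, mul_comm (Equiv.Perm.sign σ), ← mul_assoc,
      Int.units_mul_self, one_mul]

/-- Swapping two boxes of one column negates the highest weight vector and commutes with the action,
so it negates all of `S^ν V`. A coordinate fixed by the swap is then its own negative. -/
theorem repr_eq_zero_of_mem_schur {ν : List ℕ} {z : ⨂[ℂ] _ : Box ν, V} (hz : z ∈ schur sl e ν)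
    {f : Box ν → ℕ} {c d : Box ν} (hcd : c ≠ d) (hcol : boxCol ν c = boxCol ν d)
    (hf : f c = f d) : (tensorBasis (Box ν)).repr z f = 0 := by
  let τ := Equiv.swap c d
  let Z : Submodule ℂ (⨂[ℂ] _ : Box ν, V) :=
    { carrier := {z | PiTensorProduct.reindex ℂ (fun _ => V) τ z = -z}
      add_mem' := fun {a b} ha hb => by
        change PiTensorProduct.reindex ℂ (fun _ => V) τ (a + b) = -(a + b)
        rw [map_add, show _ = _ from ha, show _ = _ from hb, neg_add]
      zero_mem' := by
        change PiTensorProduct.reindex ℂ (fun _ => V) τ 0 = -0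
        rw [map_zero, neg_zero]
      smul_mem' := fun k a ha => by
        change PiTensorProduct.reindex ℂ (fun _ => V) τ (k • a) = -(k • a)
        rw [map_smul, show _ = _ from ha, smul_neg] }
  have hle : (schur sl e ν).toSubmodule ≤ Z := by
    refine schur_le e ν ?_ fun x z hz => ?_
    swap
    · change PiTensorProduct.reindex ℂ (fun _ => V) τ _ = -_
      rw [← der_reindex, show _ = _ from hz, map_neg]
    change PiTensorProduct.reindex ℂ (fun _ => V) τ _ = -_
    rw [highestWeightVector_eq, reindex_colAlt, Equiv.Perm.sign_swap hcd]
    · simp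
    · intro b
      by_cases h1 : b = c
      · subst h1; simp [τ, hcol]
      · by_cases h2 : b = d
        · subst h2; simp [τ, hcol]
        · simp only [τ, Equiv.swap_apply_of_ne_of_ne h1 h2]
  have h1 : PiTensorProduct.reindex ℂ (fun _ => V) τ z = -z := hle hz
  have h2 := repr_reindex τ z f
  have h3 : (fun b => f (τ b)) = f := by
    funext b
    by_cases h1 : b = c
    · subst h1; simp [τ, hf]
    · by_cases h2 : b = d
      · subst h2; simp [τ, hf]
      · simp only [τ, Equiv.swap_apply_of_ne_of_ne h1 h2]
  rw [h1, h3, map_neg, Finsupp.neg_apply] at h2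
  exact self_eq_neg.1 h2.symm

/-! ### Left ends -/

namespace AdmissibleOrder

variable (P : AdmissibleOrder)

/-- A finite set that is closed downwards contains left ends of all lengths up to its size. -/
theorem exists_isLeftEnd (I : Finset ℕ) (hI : ∀ m, ∀ a ∈ I, P.lt m a → m ∈ I) (k : ℕ)
    (hk : k ≤ I.card) : ∃ i : Fin k → ℕ, P.IsLeftEnd i ∧ ∀ s, i s ∈ I := by
  induction k with
  | zero => exact ⟨Fin.elim0, ⟨fun s => s.elim0, fun s => s.elim0, fun _ _ s => s.elim0⟩,
      fun s => s.elim0⟩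
  | succ k ih =>
    obtain ⟨i, hi, hiI⟩ := ih (by omega)
    let J := I \ Finset.univ.image i
    have hJ : J.Nonempty := by
      rw [← Finset.card_pos]
      have h1 := Finset.le_card_sdiff (Finset.univ.image i) I
      have h2 : (Finset.univ.image i).card ≤ k := by
        simpa using Finset.card_image_le (s := (Finset.univ : Finset (Fin k))) (f := i)
      change 0 < (I \ Finset.univ.image i).card
      omega
    have hmem : ∀ m, m ∈ J ↔ m ∈ I ∧ ∀ s, i s ≠ m := fun m => by simp [J]
    -- A `≺`-minimal element among those not yet used can be appended: all its predecessors are in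
    -- `I` and already listed.
    obtain ⟨a, haJ, hmin⟩ : ∃ a ∈ J, ∀ m ∈ J, ¬ P.lt m a := by
      let _ : IsStrictOrder ℕ P.lt := { irrefl := P.irrefl, trans := P.trans }
      have hwf : (J : Set ℕ).WellFoundedOn P.lt := J.finite_toSet.wellFoundedOn
      obtain ⟨a, -, ha⟩ := hwf.has_min Set.univ ⟨⟨hJ.choose, hJ.choose_spec⟩, trivial⟩
      exact ⟨a, a.2, fun m hm => ha ⟨m, hm⟩ trivial⟩
    obtain ⟨haI, hai⟩ := (hmem a).1 haJ
    refine ⟨Fin.snoc i a, ⟨?_, ?_, ?_⟩, ?_⟩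
    · intro s t
      induction s using Fin.lastCases <;> induction t using Fin.lastCases
      · simp
      · intro h; simp only [Fin.snoc_last, Fin.snoc_castSucc] at h
        exact absurd h.symm (hai _)
      · intro h; simp only [Fin.snoc_last, Fin.snoc_castSucc] at h
        exact absurd h (hai _)
      · intro h; simp only [Fin.snoc_castSucc] at h
        rw [hi.injective h]
    · intro s t
      induction s using Fin.lastCases <;> induction t using Fin.lastCases
      · intro h; exact absurd h (P.irrefl _)
      · intro h; simp only [Fin.snoc_last, Fin.snoc_castSucc] at h
        exact absurd h (hi.not_lt a hai _)
      · intro _; exact Fin.castSucc_lt_last _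
      · intro h; simp only [Fin.snoc_castSucc] at h
        exact Fin.castSucc_lt_castSucc_iff.2 (hi.lt_of_lt _ _ h)
    · intro m hm s
      have hm' : ∀ s, i s ≠ m := fun s => by simpa using hm s.castSucc
      induction s using Fin.lastCases with
      | last =>
        rw [Fin.snoc_last]
        intro h
        exact hmin m ((hmem m).2 ⟨hI m a haI h, hm'⟩) h
      | cast s => rw [Fin.snoc_castSucc]; exact hi.not_lt m hm' s
    · intro s
      induction s using Fin.lastCases with
      | last => simpa using haI
      | cast s => simpa using hiI s

/-- Indices in a coordinate of an invariant vector form a set that is closed downwards. -/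
theorem range_closed_of_invariant {B : Type} [Fintype B] [DecidableEq B] {z : ⨂[ℂ] _ : B, V}
    (hz : ∀ a b, P.lt a b → der (E a b) z = 0) {f : B → ℕ} (hf : (tensorBasis B).repr z f ≠ 0)
    {m : ℕ} {c : B} (hm : P.lt m (f c)) : ∃ d, f d = m := by
  by_contra! hne
  -- If `m` were missing from `f`, the coordinate of `E m (f c) z` at `f` with entry `c` replaced by
  -- `m` would have a single summand, namely the nonzero coordinate of `z` at `f`.
  have h := repr_der_E m (f c) z (Function.update f c m)
  rw [hz m (f c) hm, map_zero, Finsupp.zero_apply, Finset.sum_eq_single c] at h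
  · simp at h
    exact hf h.symm
  · intro d _ hd
    rw [if_neg]
    rw [Function.update_of_ne hd]
    exact hne d
  · simp

/-- The entries of a nonzero coordinate are closed downwards by invariance and, since the first
column has `ν.length` boxes with distinct entries, numerous enough for `exists_isLeftEnd`. -/
theorem exists_isLeftEnd_of_invariant {ν : List ℕ} (hpos : ∀ a ∈ ν, 0 < a)
    {z : ⨂[ℂ] _ : Box ν, V} (hzν : z ∈ schur sl e ν) (hz0 : z ≠ 0)
    (hz : ∀ a b, P.lt a b → der (E a b) z = 0) : ∃ i : Fin ν.length → ℕ, P.IsLeftEnd i := by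
  obtain ⟨f, hf⟩ : ∃ f, (tensorBasis (Box ν)).repr z f ≠ 0 := by
    by_contra! h
    exact hz0 ((tensorBasis (Box ν)).ext_elem fun f => by rw [h f]; simp)
  have hcard : ν.length ≤ (Finset.univ.image f).card := by
    -- Box `g r` is the first box of row `r`; it exists because all parts are positive.
    let g : Fin ν.length → Box ν := fun r => ⟨r, ⟨0, hpos _ (List.get_mem _ _)⟩⟩
    have hinj : Function.Injective fun r => f (g r) := fun r s hrs => by
      by_contra hne
      exact hf (repr_eq_zero_of_mem_schur hzν (c := g r) (d := g s)
        (fun h => hne (congrArg Sigma.fst h)) rfl hrs)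
    calc ν.length = (Finset.univ.image fun r => f (g r)).card := by
          rw [Finset.card_image_of_injective _ hinj, Finset.card_univ, Fintype.card_fin]
      _ ≤ _ := Finset.card_le_card fun x hx => by
          obtain ⟨r, -, rfl⟩ := Finset.mem_image.1 hx
          exact Finset.mem_image_of_mem _ (Finset.mem_univ _)
  obtain ⟨i, hi, -⟩ := P.exists_isLeftEnd (Finset.univ.image f) (fun m a ha hma => by
    obtain ⟨c, -, rfl⟩ := Finset.mem_image.1 ha
    obtain ⟨d, rfl⟩ := P.range_closed_of_invariant hz hf hma
    exact Finset.mem_image_of_mem _ (Finset.mem_univ _)) _ hcard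
  exact ⟨i, hi⟩

/-! ### Nonzero invariants in aligned modules -/

theorem adjoin_range_ι_eq_top (L : Type) [LieRing L] [LieAlgebra ℂ L] :
    Algebra.adjoin ℂ (Set.range (UniversalEnvelopingAlgebra.ι ℂ (L := L))) = ⊤ := by
  let A := Algebra.adjoin ℂ (Set.range (UniversalEnvelopingAlgebra.ι ℂ (L := L)))
  let f : L →ₗ⁅ℂ⁆ A :=
    { toFun := fun x => ⟨UniversalEnvelopingAlgebra.ι ℂ x, Algebra.subset_adjoin ⟨x, rfl⟩⟩
      map_add' := fun x y => Subtype.ext (map_add _ _ _)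
      map_smul' := fun c x => Subtype.ext (map_smul _ _ _)
      map_lie' := fun {x y} => Subtype.ext (LieHom.map_lie _ _ _) }
  have h : A.val.comp (UniversalEnvelopingAlgebra.lift ℂ f) = AlgHom.id ℂ _ := by
    refine UniversalEnvelopingAlgebra.hom_ext ℂ (LieHom.ext fun x => ?_)
    change ((UniversalEnvelopingAlgebra.lift ℂ f (UniversalEnvelopingAlgebra.ι ℂ x) : A) :
      UniversalEnvelopingAlgebra ℂ L) = UniversalEnvelopingAlgebra.ι ℂ x
    rw [UniversalEnvelopingAlgebra.lift_ι_apply]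
    rfl
  refine (Algebra.eq_top_iff).2 fun u => ?_
  have hu := AlgHom.congr_fun h u
  rw [AlgHom.id_apply] at hu
  rw [← hu]
  exact (UniversalEnvelopingAlgebra.lift ℂ f u).2

/-- An aligned module has nonzero invariants. -/
theorem IsAligned.exists_invariant {M : Type} [AddCommGroup M] [Module ℂ M] [LieRingModule sl M]
    [LieModule ℂ sl M] (h : P.IsAligned M) : ∃ m : M, m ≠ 0 ∧ m ∈ P.invariantSpace M := by
  obtain ⟨hirr, -, S, _, _, _, _, -, -, φ, hφ, hφι⟩ := h
  have hnt : Nontrivial M := LieModule.nontrivial_of_isIrreducible ℂ sl M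
  have hact : ∀ (u : U) (w : P.GenVerma S), φ w = 0 → φ (u • w) = 0 := by
    intro u w hw
    have : ∀ u : U, u ∈ Algebra.adjoin ℂ (Set.range (UniversalEnvelopingAlgebra.ι ℂ (L := sl))) →
        ∀ w : P.GenVerma S, φ w = 0 → φ (u • w) = 0 := by
      intro u hu
      induction hu using Algebra.adjoin_induction with
      | mem u hu =>
        obtain ⟨x, rfl⟩ := hu
        intro w hw
        rw [hφι, hw, lie_zero]
      | algebraMap r =>
        intro w hw
        rw [algebraMap_smul, map_smul, hw, smul_zero]
      | add a b _ _ ha hb =>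
        intro w hw
        rw [add_smul, map_add, ha w hw, hb w hw, add_zero]
      | mul a b _ _ ha hb =>
        intro w hw
        rw [mul_smul]
        exact ha _ (hb w hw)
    exact this u (by rw [adjoin_range_ι_eq_top]; trivial) w hw
  -- The vectors `1 ⊗ s` generate the generalized Verma module over `U(𝔤)`; if `φ` killed them all
  -- it would be zero, although it is onto a nonzero module.
  have hex : ∃ s : S, φ (Submodule.Quotient.mk (1 ⊗ₜ[ℂ] s)) ≠ 0 := by
    by_contra! h0
    obtain ⟨m, hm⟩ := exists_ne (0 : M)
    obtain ⟨w, rfl⟩ := hφ m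
    refine hm ?_
    clear hm
    obtain ⟨t, rfl⟩ := Submodule.Quotient.mk_surjective _ w
    induction t using TensorProduct.induction_on with
    | zero => rw [Submodule.Quotient.mk_zero, map_zero]
    | tmul u s =>
      have : (u ⊗ₜ[ℂ] s : U ⊗[ℂ] S) = u • (1 ⊗ₜ[ℂ] s) := by
        rw [TensorProduct.smul_tmul', smul_eq_mul, mul_one]
      rw [this, Submodule.Quotient.mk_smul]
      exact hact _ _ (h0 s)
    | add a b ha hb =>
      have h : (Submodule.Quotient.mk (a + b) : P.GenVerma S) =
        Submodule.Quotient.mk a + Submodule.Quotient.mk b := rfl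
      rw [h, map_add, ha, hb, add_zero]
  obtain ⟨s, hs⟩ := hex
  refine ⟨_, hs, fun y hy => ?_⟩
  have h : (Submodule.Quotient.mk (UniversalEnvelopingAlgebra.ι ℂ y ⊗ₜ[ℂ] s) :
      P.GenVerma S) = 0 :=
    (Submodule.Quotient.mk_eq_zero _).2 (Submodule.subset_span (Or.inr ⟨⟨y, hy⟩, s, rfl⟩))
  rw [← hφι, ← Submodule.Quotient.mk_smul, TensorProduct.smul_tmul', smul_eq_mul, mul_one, h,
    map_zero]

end AdmissibleOrder

end SlInf

/-! ### Cyclic tensor products -/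

namespace TensorAction

section

variable {ι : Type} [DecidableEq ι] [Fintype ι] {L : Type} [LieRing L] [LieAlgebra ℂ L]
  {M : ι → Type} [∀ i, AddCommGroup (M i)] [∀ i, Module ℂ (M i)]
  [∀ i, LieRingModule L (M i)] [∀ i, LieModule ℂ L (M i)]

theorem lie_tprod_of_lie_eq_zero (x : L) (m : ∀ i, M i) (j : ι)
    (h : ∀ l, l ≠ j → ∀ z : M l, ⁅x, z⁆ = 0) :
    ⁅x, PiTensorProduct.tprod ℂ m⁆ =
      PiTensorProduct.tprod ℂ (Function.update m j ⁅x, m j⁆) := by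
  rw [lie_tprod, Finset.sum_eq_single j]
  · intro l _ hl
    refine MultilinearMap.map_coord_zero _ l ?_
    rw [Function.update_self, h l hl]
  · exact fun h => absurd (Finset.mem_univ j) h

/-- If every factor is generated by elements of `L` that kill the other factors, then the tensor
product is generated by the tensor product of the generators. -/
theorem eq_top_of_tprod_mem {v : ∀ i, M i} {G : ι → Set L}
    (hG : ∀ i, ∀ x ∈ G i, ∀ l, l ≠ i → ∀ z : M l, ⁅x, z⁆ = 0)
    (hgen : ∀ i (Q : Submodule ℂ (M i)), v i ∈ Q → (∀ x ∈ G i, ∀ z ∈ Q, ⁅x, z⁆ ∈ Q) → ∀ z, z ∈ Q)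
    {Y : Submodule ℂ (⨂[ℂ] i, M i)} (hv : PiTensorProduct.tprod ℂ v ∈ Y)
    (hY : ∀ (x : L), ∀ z ∈ Y, ⁅x, z⁆ ∈ Y) : Y = ⊤ := by
  -- Induction on the set of factors in which `m` may differ from the generator. In a new factor
  -- `j`, the vectors that keep the pure tensor in `Y` form a subspace stable under `G j`, because
  -- elements of `G j` move no other factor.
  have key : ∀ (S : Finset ι) (m : ∀ i, M i), (∀ j ∉ S, m j = v j) →
      PiTensorProduct.tprod ℂ m ∈ Y := by
    intro S
    induction S using Finset.induction_on with
    | empty =>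
      intro m hm
      rw [show m = v from funext fun j => hm j (Finset.notMem_empty j)]
      exact hv
    | insert j S hj ih =>
      intro m hm
      let F : M j →ₗ[ℂ] ⨂[ℂ] i, M i := (PiTensorProduct.tprod ℂ).toLinearMap m j
      have hF : ∀ z, F z = PiTensorProduct.tprod ℂ (Function.update m j z) := fun _ => rfl
      have h2 : m j ∈ Y.comap F := by
        refine hgen j (Y.comap F) ?_ ?_ (m j)
        · rw [Submodule.mem_comap, hF]
          refine ih _ fun l hl => ?_
          by_cases hlj : l = j
          · subst hlj; rw [Function.update_self]
          · rw [Function.update_of_ne hlj]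
            exact hm l (by simp [hlj, hl])
        · intro x hx z hz
          rw [Submodule.mem_comap, hF] at hz ⊢
          have h1 := hY x _ hz
          rwa [lie_tprod_of_lie_eq_zero x _ j (hG j x hx), Function.update_self,
            Function.update_idem] at h1
      rwa [Submodule.mem_comap, hF, Function.update_eq_self] at h2
  rw [eq_top_iff, ← PiTensorProduct.span_tprod_eq_top, Submodule.span_le]
  rintro _ ⟨m, rfl⟩
  exact key Finset.univ m fun j hj => absurd (Finset.mem_univ j) hj

end

end TensorAction

open TensorAction

namespace SlInf

namespace AdmissibleOrder

variable (P : AdmissibleOrder)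

/-! ### Rearranging a left end inside its blocks -/

section

variable {k : ℕ} (i : Fin k → ℕ)

open Classical in
/-- The indices `s` with `i s ∈ [p]`, in their order. -/
def blockList (p : ℕ) : List (Fin k) :=
  (List.finRange k).filter fun s => i s ∈ block P.lt p

theorem mem_blockList {p : ℕ} {s : Fin k} : s ∈ P.blockList i p ↔ i s ∈ block P.lt p := by
  simp [blockList]

theorem nodup_blockList (p : ℕ) : (P.blockList i p).Nodup :=
  (List.nodup_finRange k).filter _

theorem blockList_congr {p q : ℕ} (h : block P.lt q = block P.lt p) :
    P.blockList i q = P.blockList i p := by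
  unfold blockList
  rw [h]

/-- Distinct `i s` in `[p]` force a finite block to be large enough, which keeps `Nat.nth` away from
its default value in the next lemmas. -/
theorem length_blockList_le {i : Fin k → ℕ} (hi : Function.Injective i) (p : ℕ)
    (hf : (Set.ofPred (· ∈ block P.lt p)).Finite) :
    (P.blockList i p).length ≤ hf.toFinset.card := by
  classical
  rw [← List.toFinset_card_of_nodup (P.nodup_blockList i p),
    ← Finset.card_image_of_injective _ hi]
  refine Finset.card_le_card fun x hx => ?_
  obtain ⟨s, hs, rfl⟩ := Finset.mem_image.1 hx
  rw [Set.Finite.mem_toFinset]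
  exact (P.mem_blockList i).1 (List.mem_toFinset.1 hs)

theorem nth_mem_block {i : Fin k → ℕ} (hi : Function.Injective i) {p r : ℕ}
    (hr : r < (P.blockList i p).length) : Nat.nth (· ∈ block P.lt p) r ∈ block P.lt p :=
  Nat.nth_mem (p := (· ∈ block P.lt p)) r fun hf => hr.trans_le (P.length_blockList_le hi p hf)

theorem nth_block_inj {i : Fin k → ℕ} (hi : Function.Injective i) {p r r' : ℕ}
    (hr : r < (P.blockList i p).length) (hr' : r' < (P.blockList i p).length)
    (h : Nat.nth (· ∈ block P.lt p) r = Nat.nth (· ∈ block P.lt p) r') : r = r' := by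
  by_cases hf : (Set.ofPred (· ∈ block P.lt p)).Finite
  · exact Nat.nth_injOn hf (hr.trans_le (P.length_blockList_le hi p hf))
      (hr'.trans_le (P.length_blockList_le hi p hf)) h
  · exact Nat.nth_injective hf h

/-- The left end that uses the smallest elements of each block, in their usual order. -/
def sortedEnd (s : Fin k) : ℕ :=
  Nat.nth (· ∈ block P.lt (i s)) ((P.blockList i (i s)).idxOf s)

theorem idxOf_lt (s : Fin k) : (P.blockList i (i s)).idxOf s < (P.blockList i (i s)).length :=
  List.idxOf_lt_length_iff.2 ((P.mem_blockList i).2 (P.mem_block_self _))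

theorem sortedEnd_get (p : ℕ) (r : Fin (P.blockList i p).length) :
    P.sortedEnd i ((P.blockList i p).get r) = Nat.nth (· ∈ block P.lt p) r := by
  have h := P.block_eq ((P.mem_blockList i).1 (List.get_mem (P.blockList i p) r))
  unfold sortedEnd
  rw [P.blockList_congr i h, h]
  congr 1
  exact (P.nodup_blockList i p).idxOf_getElem _ _

variable {i}

theorem sortedEnd_mem (hi : Function.Injective i) (s : Fin k) :
    P.sortedEnd i s ∈ block P.lt (i s) :=
  P.nth_mem_block hi (P.idxOf_lt i s)

theorem sortedEnd_injective (hi : Function.Injective i) : Function.Injective (P.sortedEnd i) := by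
  intro s t hst
  have hb : block P.lt (i s) = block P.lt (i t) := by
    rw [← P.block_eq (P.sortedEnd_mem hi s), ← P.block_eq (P.sortedEnd_mem hi t), hst]
  have h1 := P.idxOf_lt i s
  unfold sortedEnd at hst
  rw [P.blockList_congr i hb] at hst h1
  rw [hb] at hst
  have h2 := P.nth_block_inj hi h1 (P.idxOf_lt i t) hst
  have hs : s ∈ P.blockList i (i t) := (P.mem_blockList i).2 (by
    rw [← hb]; exact P.mem_block_self _)
  exact (List.idxOf_inj hs).1 h2

/-- Every element of `[m]` precedes `i s`, so the left end exhausts `[m]`. There `sortedEnd` takes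
distinct values among the same elements and merely permutes them; thus `m` is attained at some `t`
with `i t` in `[m]`, and `i t ≺ i s` gives `t < s`. -/
theorem exists_sortedEnd_eq (hi : P.IsLeftEnd i) {m : ℕ} {s : Fin k}
    (hm : P.lt m (P.sortedEnd i s)) : ∃ t < s, P.sortedEnd i t = m := by
  classical
  have hms : P.lt m (i s) :=
    P.lt_of_mem_right (P.mem_block_symm (P.sortedEnd_mem hi.injective s)) hm
  have hlt : ∀ a ∈ block P.lt m, P.lt a (i s) := fun a ha =>
    P.lt_of_mem_left (P.mem_block_symm ha) hms
  have hrange : ∀ a ∈ block P.lt m, ∃ t, i t = a := fun a ha => by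
    by_contra! hne
    exact hi.not_lt a hne s (hlt a ha)
  let T : Finset (Fin k) := Finset.univ.filter fun t => i t ∈ block P.lt m
  have hT : ∀ t, t ∈ T ↔ i t ∈ block P.lt m := fun t => by simp [T]
  have hsub : T.image (P.sortedEnd i) ⊆ T.image i := by
    intro x hx
    obtain ⟨t, ht, rfl⟩ := Finset.mem_image.1 hx
    have h1 : P.sortedEnd i t ∈ block P.lt m := by
      rw [← P.block_eq ((hT t).1 ht)]; exact P.sortedEnd_mem hi.injective t
    obtain ⟨u, hu⟩ := hrange _ h1
    exact Finset.mem_image.2 ⟨u, (hT u).2 (by rw [hu]; exact h1), hu⟩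
  -- Both images have the cardinality of `T` by injectivity.
  have heq := Finset.eq_of_subset_of_card_le hsub (by
    rw [Finset.card_image_of_injective _ hi.injective,
      Finset.card_image_of_injective _ (P.sortedEnd_injective hi.injective)])
  obtain ⟨u, hu⟩ := hrange m (P.mem_block_self m)
  have hmem : m ∈ T.image (P.sortedEnd i) := by
    rw [heq]
    exact Finset.mem_image.2 ⟨u, (hT u).2 (by rw [hu]; exact P.mem_block_self m), hu⟩
  obtain ⟨t, ht, htm⟩ := Finset.mem_image.1 hmem
  exact ⟨t, hi.lt_of_lt _ _ (hlt _ ((hT t).1 ht)), htm⟩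

theorem BlockIndex.eq_of_block_eq {j j' : P.BlockIndex i}
    (h : block P.lt (i j.1) = block P.lt (i j'.1)) : j = j' := by
  rcases lt_trichotomy j.1 j'.1 with hlt | heq | hlt
  · exact absurd (by rw [← h]; exact P.mem_block_self _) (j'.2 _ hlt)
  · exact Subtype.ext heq
  · exact absurd (by rw [h]; exact P.mem_block_self _) (j.2 _ hlt)

theorem BlockIndex.exists_mem (s : Fin k) : ∃ j : P.BlockIndex i, i s ∈ block P.lt (i j.1) := by
  classical
  let T : Finset (Fin k) := Finset.univ.filter fun t => i t ∈ block P.lt (i s)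
  have hT : ∀ t, t ∈ T ↔ i t ∈ block P.lt (i s) := fun t => by simp [T]
  have hne : T.Nonempty := ⟨s, (hT s).2 (P.mem_block_self _)⟩
  have h1 := (hT _).1 (T.min'_mem hne)
  refine ⟨⟨T.min' hne, fun t ht hmem => ?_⟩, P.mem_block_symm h1⟩
  rw [P.block_eq h1] at hmem
  exact absurd (T.min'_le t ((hT t).2 hmem)) (not_le.2 ht)

end

/-! ### Boxes of `μ` by blocks -/

section

variable (μ : List ℕ) (i : Fin μ.length → ℕ)

theorem length_subPartition (p : ℕ) :
    (P.subPartition μ i p).length = (P.blockList i p).length := by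
  simp [subPartition, blockList]

/-- The row of `μ` that is row `r` of `μ[p]`. -/
def rowOf (p : ℕ) (r : Fin (P.subPartition μ i p).length) : Fin μ.length :=
  (P.blockList i p).get (r.cast (P.length_subPartition μ i p))

theorem get_subPartition (p : ℕ) (r : Fin (P.subPartition μ i p).length) :
    (P.subPartition μ i p).get r = μ.get (P.rowOf μ i p r) := by
  exact List.getElem_map (l := P.blockList i p) μ.get (h := r.2)

theorem rowOf_mem (p : ℕ) (r : Fin (P.subPartition μ i p).length) :
    i (P.rowOf μ i p r) ∈ block P.lt p :=
  (P.mem_blockList i).1 (List.get_mem _ _)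

theorem sortedEnd_rowOf (p : ℕ) (r : Fin (P.subPartition μ i p).length) :
    P.sortedEnd i (P.rowOf μ i p r) = Nat.nth (· ∈ block P.lt p) r :=
  P.sortedEnd_get i p _

/-- Boxes of the partitions `μ[p]` as boxes of `μ`. -/
def boxMap (x : Σ j : P.BlockIndex i, Box (P.subPartition μ i (i j.1))) : Box μ :=
  ⟨P.rowOf μ i _ x.2.1, x.2.2.cast (P.get_subPartition μ i _ _)⟩

theorem boxMap_bijective : Function.Bijective (P.boxMap μ i) := by
  constructor
  · rintro ⟨j, r, c⟩ ⟨j', r', c'⟩ h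
    have h1 : P.rowOf μ i _ r = P.rowOf μ i _ r' := congrArg Sigma.fst h
    have h2 : (c : ℕ) = c' := congrArg (fun b : Box μ => (b.2 : ℕ)) h
    have hj : j = j' := BlockIndex.eq_of_block_eq P (by
      rw [← P.block_eq (P.rowOf_mem μ i _ r), ← P.block_eq (P.rowOf_mem μ i _ r'), h1])
    subst hj
    have hr : r = r' := by
      have h3 := congrArg Fin.val ((P.nodup_blockList i (i j.1)).injective_get h1)
      exact Fin.ext h3
    subst hr
    rw [Fin.ext h2]
  · rintro ⟨s, c⟩
    obtain ⟨j, hj⟩ := BlockIndex.exists_mem P (i := i) s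
    obtain ⟨r, hr⟩ := List.get_of_mem ((P.mem_blockList i).2 hj)
    let r' := r.cast (P.length_subPartition μ i (i j.1)).symm
    have hr' : P.rowOf μ i (i j.1) r' = s := hr
    subst hr'
    exact ⟨⟨j, r', c.cast (P.get_subPartition μ i _ _).symm⟩, rfl⟩

/-- The boxes of `μ`, sorted by blocks. -/
def boxEquiv : (Σ j : P.BlockIndex i, Box (P.subPartition μ i (i j.1))) ≃ Box μ :=
  Equiv.ofBijective _ (P.boxMap_bijective μ i)

theorem boxEquiv_fst (x : Σ j : P.BlockIndex i, Box (P.subPartition μ i (i j.1))) :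
    (P.boxEquiv μ i x).1 = P.rowOf μ i _ x.2.1 := rfl

/-- For rows of `μ[p]` the default value 0 of `blockBasis` never occurs; this identifies the highest
weight vectors of the blocks with the entries of the sorted left end. -/
theorem coe_blockBasis {i : Fin μ.length → ℕ} (hi : Function.Injective i) (p : ℕ)
    (r : Fin (P.subPartition μ i p).length) :
    (P.blockBasis p r : V) = e (P.sortedEnd i (P.rowOf μ i p r)) := by
  have h : Nat.nth (· ∈ block P.lt p) r ∈ block P.lt p :=
    P.nth_mem_block hi (by rw [← P.length_subPartition μ i p]; exact r.2)
  unfold blockBasis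
  rw [dif_pos h, sortedEnd_rowOf]

end

/-! ### Generation of `S^ν V_[p]` by root vectors of its block -/

theorem mem_levi_of_E {x : sl} {a b : ℕ} (hab : a ≠ b) (h : b ∈ block P.lt a)
    (hx : (x : Module.End ℂ V) = E a b) : x ∈ P.levi :=
  LieSubalgebra.subset_lieSpan (Or.inr ⟨a, b, hab, h, hx⟩)

theorem sub_mem_sl (a b : ℕ) : E a a - E b b ∈ sl := by
  by_cases h : a = b
  · subst h; rw [sub_self]; exact sl.zero_mem
  · have := sl.lie_mem (rootVector h).2 (rootVector (Ne.symm h)).2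
    rw [coe_rootVector, coe_rootVector, E_lie_E, if_pos rfl, if_pos rfl] at this
    exact this

/-- Same-block relation. -/
def sameBlock (a b : ℕ) : Prop := b ∈ block P.lt a

theorem sameBlock_trans (a b c : ℕ) (h1 : P.sameBlock a b) (h2 : P.sameBlock b c) :
    P.sameBlock a c := by
  unfold sameBlock at *
  rwa [P.block_eq h1] at h2

/-- Root vectors and Cartan elements in `𝔩(≺)`. -/
def leviGens : Set P.levi := {x | ((x : sl) : Module.End ℂ V) ∈ gens P.sameBlock}

theorem gens_subset_levi {y : Module.End ℂ V} (hy : y ∈ gens P.sameBlock) :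
    ∃ x : P.levi, ((x : sl) : Module.End ℂ V) = y := by
  rcases hy with ⟨a, b, hab, h, rfl⟩ | ⟨a, b, rfl⟩
  · exact ⟨⟨rootVector hab, P.mem_levi_of_E hab h rfl⟩, rfl⟩
  · exact ⟨⟨⟨_, sub_mem_sl a b⟩, LieSubalgebra.subset_lieSpan
      (Or.inl (Submodule.subset_span ⟨a, b, rfl⟩))⟩, rfl⟩

theorem levi_mem_span_gens {x : sl} (hx : x ∈ P.levi) :
    (x : Module.End ℂ V) ∈ Submodule.span ℂ (gens P.sameBlock) := by
  let K : LieSubalgebra ℂ sl :=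
    { (Submodule.span ℂ (gens P.sameBlock)).comap (sl.incl : sl →ₗ[ℂ] Module.End ℂ V) with
      lie_mem' := fun hx hy => lie_mem_span_gens P.sameBlock_trans hx hy }
  have : P.levi ≤ K := LieSubalgebra.lieSpan_le.2 (by
    rintro x (hx | ⟨a, b, hab, h, hx⟩)
    · have : cartan ≤ K.toSubmodule := Submodule.span_le.2 (by
        rintro x ⟨a, b, hx⟩
        change (x : Module.End ℂ V) ∈ Submodule.span ℂ (gens P.sameBlock)
        rw [hx]
        exact sub_mem_span_gens _ a b)
      exact this hx
    · change (x : Module.End ℂ V) ∈ Submodule.span ℂ (gens P.sameBlock)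
      rw [hx]
      exact E_mem_span_gens hab h)
  exact this hx

theorem span_leviGens : Submodule.span ℂ P.leviGens = ⊤ := by
  let f : P.levi →ₗ[ℂ] Module.End ℂ V := (sl.incl : sl →ₗ[ℂ] Module.End ℂ V) ∘ₗ
    (P.levi.incl : P.levi →ₗ[ℂ] sl)
  have hf : Function.Injective f := fun x y h => Subtype.ext (Subtype.ext h)
  have himg : f '' P.leviGens = gens P.sameBlock := by
    ext y
    constructor
    · rintro ⟨x, hx, rfl⟩; exact hx
    · intro hy
      obtain ⟨x, rfl⟩ := P.gens_subset_levi hy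
      exact ⟨x, hy, rfl⟩
  rw [eq_top_iff]
  intro x _
  have hx : f x ∈ Submodule.span ℂ (f '' P.leviGens) := by
    rw [himg]; exact P.levi_mem_span_gens x.2
  rw [Submodule.span_image] at hx
  obtain ⟨y, hy, hyx⟩ := hx
  rwa [← hf hyx]

theorem coe_toEnd_blockSpace (p : ℕ) (x : P.levi) (v : P.blockSpace p) :
    ((LieModule.toEnd ℂ P.levi (P.blockSpace p) x v : P.blockSpace p) : V) =
      ((x : sl) : Module.End ℂ V) (v : V) := rfl

theorem E_eq_zero_on_blockSpace {p a b : ℕ} (hb : b ∉ block P.lt p) (v : P.blockSpace p) :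
    E a b (v : V) = 0 := by
  have h : P.blockSpan p ≤ LinearMap.ker (E a b) := Submodule.span_le.2 (by
    rintro _ ⟨m, hm, rfl⟩
    rw [SetLike.mem_coe, LinearMap.mem_ker, E_apply_e, if_neg]
    rintro rfl
    exact hb hm)
  exact h v.2

theorem toEnd_blockSpace_eq_zero {p a b : ℕ} (hb : b ∉ block P.lt p) {x : P.levi}
    (hx : ((x : sl) : Module.End ℂ V) = E a b) :
    LieModule.toEnd ℂ P.levi (P.blockSpace p) x = 0 :=
  LinearMap.ext fun v => Subtype.ext (by
    rw [coe_toEnd_blockSpace, hx, P.E_eq_zero_on_blockSpace hb]; rfl)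

theorem exists_smul_blockBasis {x : P.levi} {a b : ℕ}
    (hx : ((x : sl) : Module.End ℂ V) = E a a - E b b) (p r : ℕ) :
    ∃ k : ℂ, LieModule.toEnd ℂ P.levi (P.blockSpace p) x (P.blockBasis p r) =
      k • P.blockBasis p r := by
  unfold blockBasis
  split_ifs with h
  · refine ⟨(if Nat.nth (· ∈ block P.lt p) r = a then 1 else 0) -
      (if Nat.nth (· ∈ block P.lt p) r = b then 1 else 0), Subtype.ext ?_⟩
    rw [coe_toEnd_blockSpace, hx, LinearMap.sub_apply, E_apply_e, E_apply_e]
    change _ = _ • e _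
    rw [sub_smul]
    split_ifs <;> simp_all
  · exact ⟨0, by rw [map_zero, smul_zero]⟩

/-- Stability under the root vectors of `[p]` alone suffices: root vectors of other blocks kill
`V_[p]`, and Cartan elements scale the highest weight vector. This confines the generating operators
to one tensor factor in `blockTensor_eq_top`. -/
theorem schur_block_le {p : ℕ} {ν : List ℕ} {Z : Submodule ℂ (⨂[ℂ] _ : Box ν, P.blockSpace p)}
    (hw : highestWeightVector (P.blockBasis p) ν ∈ Z)
    (hZ : ∀ (x : P.levi) (a b : ℕ), a ≠ b → a ∈ block P.lt p → b ∈ block P.lt p →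
      ((x : sl) : Module.End ℂ V) = E a b → ∀ z ∈ Z,
        der (LieModule.toEnd ℂ P.levi (P.blockSpace p) x) z ∈ Z) :
    (schur P.levi (P.blockBasis p) ν).toSubmodule ≤ Z := by
  obtain ⟨w, hwdef⟩ : ∃ w, w = highestWeightVector (P.blockBasis p) ν := ⟨_, rfl⟩
  rw [← hwdef] at hw
  let Y : Set P.levi := {x | ∃ a b, a ≠ b ∧ a ∈ block P.lt p ∧ b ∈ block P.lt p ∧
    ((x : sl) : Module.End ℂ V) = E a b}
  let C : Submodule ℂ (⨂[ℂ] _ : Box ν, P.blockSpace p) :=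
    sInf {Z | w ∈ Z ∧ ∀ y ∈ Y, ∀ z ∈ Z, ⁅y, z⁆ ∈ Z}
  have hwC : w ∈ C := Submodule.mem_sInf.2 fun Z hZ => hZ.1
  have hYC : ∀ y ∈ Y, ∀ z ∈ C, ⁅y, z⁆ ∈ C := fun y hy z hz =>
    Submodule.mem_sInf.2 fun Z hZ => hZ.2 y hy z (Submodule.mem_sInf.1 hz Z hZ)
  have hCZ : C ≤ Z := sInf_le ⟨hw, fun y hy z hz => by
    obtain ⟨a, b, hab, ha, hb, hy⟩ := hy
    rw [lie_eq_der]
    exact hZ y a b hab ha hb hy z hz⟩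
  refine le_trans ?_ hCZ
  -- This is the hypothesis of `lie_mem_of_closure` for the line spanned by `w`, checked on a linear
  -- spanning set of `𝔩(≺)`.
  have hxw : ∀ x : P.levi, ⁅x, w⁆ ∈ C := by
    intro x
    have hx : x ∈ Submodule.span ℂ P.leviGens := by rw [P.span_leviGens]; trivial
    induction hx using Submodule.span_induction with
    | zero => rw [zero_lie]; exact C.zero_mem
    | add x y _ _ hx hy => rw [add_lie]; exact C.add_mem hx hy
    | smul c x _ hx => rw [smul_lie]; exact C.smul_mem c hx
    | mem x hx =>
      rcases hx with ⟨a, b, hab, h, hx⟩ | ⟨a, b, hx⟩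
      · by_cases hb : b ∈ block P.lt p
        · have ha : a ∈ block P.lt p := by
            rw [← P.block_eq hb]; exact P.mem_block_symm h
          exact hYC x ⟨a, b, hab, ha, hb, hx⟩ w hwC
        · rw [lie_eq_der, P.toEnd_blockSpace_eq_zero hb hx, map_zero, LinearMap.zero_apply]
          exact C.zero_mem
      · choose κ hκ using P.exists_smul_blockBasis hx p
        rw [lie_eq_der]
        have := der_colAlt_of_eigen (boxCol ν)
          (x := LieModule.toEnd ℂ P.levi (P.blockSpace p) x)
          (t := fun c : Box ν => P.blockBasis p c.1) (κ := fun c => κ c.1) fun c => hκ c.1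
        rw [← highestWeightVector_eq] at this
        rw [hwdef, this]
        exact C.smul_mem _ (hwdef ▸ hwC)
  refine schur_le _ ν (hwdef ▸ hwC) fun x z hz => ?_
  rw [← lie_eq_der]
  refine lie_mem_of_closure Y (Submodule.span ℂ {w}) C ?_ ?_ hYC ?_ x hz
  · intro Z hNZ hYZ
    exact sInf_le ⟨hNZ (Submodule.mem_span_singleton_self w), hYZ⟩
  · rw [Submodule.span_singleton_le_iff_mem]; exact hwC
  · intro x n hn
    obtain ⟨c, rfl⟩ := Submodule.mem_span_singleton.1 hn
    rw [lie_smul]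
    exact C.smul_mem c (hxw x)

theorem sBlock_mem {p : ℕ} {ν : List ℕ} (Q : Submodule ℂ (P.SBlock p ν))
    (hw : (⟨_, highestWeightVector_mem_schur (L := P.levi) (P.blockBasis p) ν⟩ :
      P.SBlock p ν) ∈ Q)
    (hQ : ∀ (x : P.levi) (a b : ℕ), a ≠ b → a ∈ block P.lt p → b ∈ block P.lt p →
      ((x : sl) : Module.End ℂ V) = E a b → ∀ z ∈ Q, ⁅x, z⁆ ∈ Q) (z : P.SBlock p ν) : z ∈ Q := by
  let f : P.SBlock p ν →ₗ[ℂ] (⨂[ℂ] _ : Box ν, P.blockSpace p) :=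
    (schur P.levi (P.blockBasis p) ν).toSubmodule.subtype
  have hle := P.schur_block_le (Z := Q.map f) ⟨_, hw, rfl⟩ (by
    rintro x a b hab ha hb hx _ ⟨z, hz, rfl⟩
    exact ⟨⁅x, z⁆, hQ x a b hab ha hb hx z hz, (lie_eq_der x (f z)).symm ▸ rfl⟩)
  obtain ⟨z', hz', hzz⟩ := hle z.2
  have : z' = z := Subtype.ext hzz
  rwa [← this]

theorem lie_sBlock_eq_zero {p a b : ℕ} {ν : List ℕ} (hb : b ∉ block P.lt p) {x : P.levi}
    (hx : ((x : sl) : Module.End ℂ V) = E a b) (z : P.SBlock p ν) : ⁅x, z⁆ = 0 := by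
  refine Subtype.ext ?_
  change ⁅x, (z : ⨂[ℂ] _ : Box ν, P.blockSpace p)⁆ = 0
  rw [lie_eq_der, P.toEnd_blockSpace_eq_zero hb hx, map_zero, LinearMap.zero_apply]

/-! ### Generation of the tensor product of the `S^{μ[p]} V_[p]` -/

section

variable (μ : List ℕ) (i : Fin μ.length → ℕ)

/-- The tensor product of the modules `S^{μ[p]} V_[p]`. -/
abbrev BlockTensor : Type := ⨂[ℂ] j : P.BlockIndex i, P.SBlock (i j.1) (P.subPartition μ i (i j.1))

/-- The highest weight vector of `S^{μ[p]} V_[p]`. -/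
def blockVector (j : P.BlockIndex i) : P.SBlock (i j.1) (P.subPartition μ i (i j.1)) :=
  ⟨highestWeightVector _ _, highestWeightVector_mem_schur _ _⟩

theorem blockTensor_eq_top {Y : Submodule ℂ (P.BlockTensor μ i)}
    (hw : PiTensorProduct.tprod ℂ (P.blockVector μ i) ∈ Y)
    (hY : ∀ (x : P.levi), ∀ z ∈ Y, ⁅x, z⁆ ∈ Y) : Y = ⊤ := by
  refine eq_top_of_tprod_mem (G := fun j => {x : P.levi | ∃ a b, a ≠ b ∧ a ∈ block P.lt (i j.1) ∧
    b ∈ block P.lt (i j.1) ∧ ((x : sl) : Module.End ℂ V) = E a b}) ?_ ?_ hw hY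
  · rintro j x ⟨a, b, hab, ha, hb, hx⟩ l hl z
    exact P.lie_sBlock_eq_zero (fun hbl => hl (BlockIndex.eq_of_block_eq P
      (by rw [← P.block_eq hb, ← P.block_eq hbl]))) hx z
  · intro j Q hQ hQ' z
    exact P.sBlock_mem Q hQ (fun x a b hab ha hb hx => hQ' x ⟨a, b, hab, ha, hb, hx⟩) z

end

end AdmissibleOrder

end SlInf

/-! ### Grouping tensor factors and antisymmetrizing within groups -/

namespace TensorAction

section

variable {J : Type} [Fintype J] [DecidableEq J] {β : J → Type} [∀ j, Fintype (β j)]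
  [∀ j, DecidableEq (β j)] {B : Type} [Fintype B] [DecidableEq B]

/-- Both sides are homomorphisms on the product of the symmetric groups, and they agree on a
transposition in a single summand. -/
theorem sign_sigmaCongrRight (r : ∀ j, Equiv.Perm (β j)) :
    Equiv.Perm.sign (Equiv.Perm.sigmaCongrRight r) = ∏ j, Equiv.Perm.sign (r j) := by
  let f : (∀ j, Equiv.Perm (β j)) →* ℤˣ :=
    Equiv.Perm.sign.comp (Equiv.Perm.sigmaCongrRightHom β)
  let g : (∀ j, Equiv.Perm (β j)) →* ℤˣ :=
    { toFun := fun r => ∏ j, Equiv.Perm.sign (r j)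
      map_one' := by simp
      map_mul' := fun r s => by simp [Finset.prod_mul_distrib] }
  have hg : ∀ j (ρ : Equiv.Perm (β j)), g (Pi.mulSingle j ρ) = Equiv.Perm.sign ρ := by
    intro j ρ
    change ∏ l, Equiv.Perm.sign ((Pi.mulSingle j ρ : ∀ l, Equiv.Perm (β l)) l) = _
    rw [Finset.prod_eq_single j]
    · rw [Pi.mulSingle_eq_same]
    · intro l _ hl
      rw [Pi.mulSingle_eq_of_ne hl, Equiv.Perm.sign_one]
    · simp
  have hfg : f = g := by
    refine MonoidHom.pi_ext fun j ρ => ?_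
    rw [hg]
    induction ρ using Equiv.Perm.swap_induction_on with
    | one => rw [Pi.mulSingle_one, map_one, map_one]
    | swap_mul ρ a b hab ih =>
      rw [Pi.mulSingle_mul, map_mul, ih, Equiv.Perm.sign_mul, Equiv.Perm.sign_swap hab]
      congr 1
      have : Equiv.Perm.sigmaCongrRightHom β (Pi.mulSingle j (Equiv.swap a b)) =
          Equiv.swap (⟨j, a⟩ : Σ j, β j) ⟨j, b⟩ := by
        refine Equiv.ext ?_
        rintro ⟨l, c⟩
        change (⟨l, (Pi.mulSingle j (Equiv.swap a b) : ∀ l, Equiv.Perm (β l)) l c⟩ : Σ j, β j) = _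
        by_cases hl : l = j
        · subst hl
          rw [Pi.mulSingle_eq_same]
          rw [Equiv.swap_apply_def, Equiv.swap_apply_def]
          simp only [Sigma.mk.injEq, heq_eq_eq, true_and]
          split_ifs <;> rfl
        · rw [Pi.mulSingle_eq_of_ne hl, Equiv.swap_apply_of_ne_of_ne]
          · rfl
          · intro h; exact hl (congrArg Sigma.fst h)
          · intro h; exact hl (congrArg Sigma.fst h)
      change Equiv.Perm.sign (Equiv.Perm.sigmaCongrRightHom β _) = _
      rw [this, Equiv.Perm.sign_swap]
      intro h
      exact hab (by simpa using h)
  exact DFunLike.congr_fun hfg r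

variable {W : Type} [AddCommGroup W] [Module ℂ W]

/-- The partial antisymmetrization along the intersections of fibres of `col` and `grp`. -/
def groupAlt (col : B → ℕ) (grp : B → J) (t : B → W) : ⨂[ℂ] _ : B, W :=
  ∑ σ : Equiv.Perm B with (∀ c, col (σ c) = col c) ∧ ∀ c, grp (σ c) = grp c,
    ((Equiv.Perm.sign σ : ℤ) : ℂ) • PiTensorProduct.tprod ℂ fun c => t (σ c)

-- The projections kill every term of the antisymmetrization whose permutation carries a vector to
-- another group and fix the remaining ones.
omit [Fintype J] in
theorem map_colAlt_eq_groupAlt (col : B → ℕ) (grp : B → J) {f : J → Module.End ℂ W} {t : B → W}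
    (h1 : ∀ c, f (grp c) (t c) = t c) (h2 : ∀ c j, grp c ≠ j → f j (t c) = 0) :
    PiTensorProduct.map (fun c => f (grp c)) (colAlt col t) = groupAlt col grp t := by
  unfold colAlt groupAlt
  rw [map_sum, ← Finset.filter_filter,
    Finset.sum_filter (p := fun σ : Equiv.Perm B => ∀ c, grp (σ c) = grp c)]
  refine Finset.sum_congr rfl fun σ _ => ?_
  rw [map_smul, PiTensorProduct.map_tprod]
  split_ifs with h
  · congr 2
    funext c
    rw [← h c, h1]
  · push Not at h
    obtain ⟨c, hc⟩ := h
    rw [MultilinearMap.map_coord_zero _ c (h2 _ _ hc), smul_zero]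

-- Each term of `groupAlt` is a column permutation of `t`, and its sign cancels on antisymmetrizing.
-- The factor is the number of terms, positive because of the identity.
omit [Fintype J] in
theorem colAltMap_groupAlt (col : B → ℕ) (grp : B → J) (t : B → W) :
    ∃ n : ℂ, n ≠ 0 ∧ colAltMap col (groupAlt col grp t) = n • colAlt col t := by
  let S : Finset (Equiv.Perm B) :=
    Finset.univ.filter fun σ => (∀ c, col (σ c) = col c) ∧ ∀ c, grp (σ c) = grp c
  refine ⟨S.card, ?_, ?_⟩
  · rw [Nat.cast_ne_zero, ← Nat.pos_iff_ne_zero, Finset.card_pos]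
    exact ⟨1, by simp [S]⟩
  · change colAltMap col (∑ σ ∈ S, _) = _
    rw [map_sum, Nat.cast_smul_eq_nsmul, ← Finset.sum_const]
    refine Finset.sum_congr rfl fun σ hσ => ?_
    rw [map_smul, colAltMap_tprod, colAlt_comp_perm col t σ (Finset.mem_filter.1 hσ).2.1, smul_smul,
      ← Int.cast_mul, ← Units.val_mul, Int.units_mul_self, Units.val_one, Int.cast_one, one_smul]

variable (ε : (Σ j, β j) ≃ B)

omit [Fintype J] [∀ j, Fintype (β j)] [Fintype B] [DecidableEq B] in
theorem tprod_sort_update [DecidableEq B] (v : B → W) (j : J) (b : β j) (x : W) :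
    (fun l => PiTensorProduct.tprod ℂ fun a : β l => Function.update v (ε ⟨j, b⟩) x (ε ⟨l, a⟩)) =
      Function.update (fun l => PiTensorProduct.tprod ℂ fun a : β l => v (ε ⟨l, a⟩)) j
        (PiTensorProduct.tprod ℂ (Function.update (fun a => v (ε ⟨j, a⟩)) b x)) := by
  funext l
  by_cases hl : l = j
  · subst hl
    rw [Function.update_self]
    congr 1
    funext a
    by_cases ha : a = b
    · subst ha; rw [Function.update_self, Function.update_self]
    · rw [Function.update_of_ne ha, Function.update_of_ne]
      intro h
      exact ha (by simpa using h)
  · rw [Function.update_of_ne hl]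
    congr 1
    funext a
    rw [Function.update_of_ne]
    intro h
    exact hl (congrArg Sigma.fst (ε.injective h))

/-- Sorting the factors of a tensor power into groups. -/
def sortFactors : (⨂[ℂ] _ : B, W) →ₗ[ℂ] ⨂[ℂ] j : J, ⨂[ℂ] _ : β j, W :=
  PiTensorProduct.lift
    { toFun := fun v =>
        PiTensorProduct.tprod ℂ fun j => PiTensorProduct.tprod ℂ fun b : β j => v (ε ⟨j, b⟩)
      map_update_add' := by
        intro _ v c x y
        obtain ⟨⟨j, b⟩, rfl⟩ := ε.surjective c
        rw [tprod_sort_update, tprod_sort_update, tprod_sort_update,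
          MultilinearMap.map_update_add, MultilinearMap.map_update_add]
      map_update_smul' := by
        intro _ v c k x
        obtain ⟨⟨j, b⟩, rfl⟩ := ε.surjective c
        rw [tprod_sort_update, tprod_sort_update,
          MultilinearMap.map_update_smul, MultilinearMap.map_update_smul] }

omit [Fintype J] [∀ j, Fintype (β j)] [Fintype B] [DecidableEq B] in
theorem sortFactors_tprod (v : B → W) : sortFactors ε (PiTensorProduct.tprod ℂ v) =
    PiTensorProduct.tprod ℂ fun j => PiTensorProduct.tprod ℂ fun b => v (ε ⟨j, b⟩) :=
  PiTensorProduct.lift.tprod v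

/-- Permutations preserving the groups are families of permutations of the single groups, with
multiplicative sign, so the sum factors. -/
theorem sortFactors_groupAlt (col : B → ℕ) (grp : B → J) (hgrp : ∀ x, grp (ε x) = x.1)
    (t : B → W) : sortFactors ε (groupAlt col grp t) =
      PiTensorProduct.tprod ℂ fun j =>
        colAlt (fun b => col (ε ⟨j, b⟩)) fun b => t (ε ⟨j, b⟩) := by
  unfold colAlt groupAlt
  rw [map_sum, MultilinearMap.map_sum_finset]
  symm
  refine Finset.sum_bij (fun r _ => ε.permCongr (Equiv.Perm.sigmaCongrRight r)) ?_ ?_ ?_ ?_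
  · intro r hr
    simp only [Fintype.mem_piFinset, Finset.mem_filter, Finset.mem_univ, true_and] at hr ⊢
    constructor
    · intro c
      obtain ⟨⟨j, b⟩, rfl⟩ := ε.surjective c
      rw [Equiv.permCongr_apply, Equiv.symm_apply_apply]
      exact hr j b
    · intro c
      obtain ⟨⟨j, b⟩, rfl⟩ := ε.surjective c
      rw [Equiv.permCongr_apply, Equiv.symm_apply_apply, hgrp, hgrp]
      rfl
  · intro r _ s _ h
    exact Equiv.Perm.sigmaCongrRightHom_injective (ε.permCongr.injective h)
  · intro σ hσ
    simp only [Finset.mem_filter, Finset.mem_univ, true_and] at hσ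
    have hex : ∀ (j : J) (b : β j), ∃ b' : β j, ε ⟨j, b'⟩ = σ (ε ⟨j, b⟩) := by
      intro j b
      obtain ⟨⟨l, b'⟩, h⟩ := ε.surjective (σ (ε ⟨j, b⟩))
      have hl : l = j := by
        have h2 := hσ.2 (ε ⟨j, b⟩)
        rw [← h, hgrp, hgrp] at h2
        exact h2
      subst hl
      exact ⟨b', h⟩
    choose r hr using hex
    have hinj : ∀ j, Function.Injective (r j) := by
      intro j a b hab
      have h : σ (ε ⟨j, a⟩) = σ (ε ⟨j, b⟩) := by rw [← hr, ← hr, hab]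
      simpa using h
    refine ⟨fun j => Equiv.ofBijective (r j) (Finite.injective_iff_bijective.1 (hinj j)), ?_, ?_⟩
    · simp only [Fintype.mem_piFinset, Finset.mem_filter, Finset.mem_univ, true_and]
      intro j b
      rw [Equiv.ofBijective_apply, hr, hσ.1]
    · refine Equiv.ext fun c => ?_
      obtain ⟨⟨j, b⟩, rfl⟩ := ε.surjective c
      rw [Equiv.permCongr_apply, Equiv.symm_apply_apply]
      exact hr j b
  · intro r _
    rw [MultilinearMap.map_smul_univ, map_smul, sortFactors_tprod]
    congr 1
    · rw [Equiv.Perm.sign_permCongr, sign_sigmaCongrRight, Units.coe_prod, Int.cast_prod]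
    · congr 1
      funext j
      congr 1
      funext b
      rw [Equiv.permCongr_apply, Equiv.symm_apply_apply]
      rfl

theorem sortFactors_der (x : Module.End ℂ W) (z : ⨂[ℂ] _ : B, W) :
    sortFactors ε (der x z) =
      ∑ j, onFactor (M := fun j => ⨂[ℂ] _ : β j, W) j (der x) (sortFactors ε z) := by
  have : sortFactors ε ∘ₗ der x =
      (∑ j, onFactor (M := fun j => ⨂[ℂ] _ : β j, W) j (der x)) ∘ₗ sortFactors ε := by
    refine PiTensorProduct.ext (MultilinearMap.ext fun t => ?_)
    rw [LinearMap.compMultilinearMap_apply, LinearMap.compMultilinearMap_apply,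
      LinearMap.comp_apply, LinearMap.comp_apply, der_tprod, map_sum, sortFactors_tprod,
      LinearMap.sum_apply]
    rw [← ε.sum_comp, Fintype.sum_sigma]
    refine Finset.sum_congr rfl fun j _ => ?_
    rw [onFactor_tprod, der_tprod, MultilinearMap.map_update_sum]
    refine Finset.sum_congr rfl fun b _ => ?_
    rw [sortFactors_tprod, tprod_sort_update]
  have h := LinearMap.congr_fun this z
  rw [LinearMap.comp_apply, LinearMap.comp_apply, LinearMap.sum_apply] at h
  exact h

omit [Fintype J] [DecidableEq J] in
theorem map_injective {M N : J → Type} [∀ j, AddCommGroup (M j)] [∀ j, Module ℂ (M j)]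
    [∀ j, AddCommGroup (N j)] [∀ j, Module ℂ (N j)] {f : ∀ j, M j →ₗ[ℂ] N j}
    (hf : ∀ j, Function.Injective (f j)) : Function.Injective (PiTensorProduct.map f) := by
  choose g hg using fun j => LinearMap.exists_leftInverse_of_injective (f j)
    (LinearMap.ker_eq_bot.2 (hf j))
  have h : PiTensorProduct.map g ∘ₗ PiTensorProduct.map f = LinearMap.id := by
    rw [← PiTensorProduct.map_comp]
    simp only [hg]
    exact PiTensorProduct.map_id
  exact Function.LeftInverse.injective (LinearMap.congr_fun h)

/-- An equivariant family of maps into a tensor power is equivariant on tensor products. -/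
theorem map_lie_eq {L : Type} [LieRing L] [LieAlgebra ℂ L] {M : J → Type}
    [∀ j, AddCommGroup (M j)] [∀ j, Module ℂ (M j)] [∀ j, LieRingModule L (M j)]
    [∀ j, LieModule ℂ L (M j)] {N : J → Type} [∀ j, AddCommGroup (N j)] [∀ j, Module ℂ (N j)]
    {f : ∀ j, M j →ₗ[ℂ] N j} {x : L} {y : ∀ j, Module.End ℂ (N j)}
    (h : ∀ j (m : M j), f j ⁅x, m⁆ = y j (f j m)) (z : ⨂[ℂ] j, M j) :
    PiTensorProduct.map f ⁅x, z⁆ = ∑ j, onFactor j (y j) (PiTensorProduct.map f z) := by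
  have : PiTensorProduct.map f ∘ₗ LieModule.toEnd ℂ L (⨂[ℂ] j, M j) x =
      (∑ j, onFactor j (y j)) ∘ₗ PiTensorProduct.map f := by
    refine PiTensorProduct.ext (MultilinearMap.ext fun t => ?_)
    rw [LinearMap.compMultilinearMap_apply, LinearMap.compMultilinearMap_apply,
      LinearMap.comp_apply, LinearMap.comp_apply, LieModule.toEnd_apply_apply, lie_tprod, map_sum,
      PiTensorProduct.map_tprod, LinearMap.sum_apply]
    refine Finset.sum_congr rfl fun j _ => ?_
    rw [onFactor_tprod, PiTensorProduct.map_tprod]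
    congr 1
    funext l
    by_cases hl : l = j
    · subst hl; rw [Function.update_self, Function.update_self, h]
    · rw [Function.update_of_ne hl, Function.update_of_ne hl]
  have h := LinearMap.congr_fun this z
  rw [LinearMap.comp_apply, LinearMap.comp_apply, LinearMap.sum_apply] at h
  exact h

end

end TensorAction

namespace SlInf

open TensorAction

/-! ### Embedding products of modules in a tensor power of `V` -/

section

variable {J : Type} [Fintype J] [DecidableEq J] {β : J → Type} [∀ j, Fintype (β j)]
  [∀ j, DecidableEq (β j)] {B : Type} [Fintype B] [DecidableEq B]

/-- Sorting the factors of a tensor power of `V` into groups, as an equivalence. -/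
def sortEquiv (ε : (Σ j, β j) ≃ B) : (⨂[ℂ] _ : B, V) ≃ₗ[ℂ] ⨂[ℂ] j : J, ⨂[ℂ] _ : β j, V :=
  (tensorBasis B).equiv (Basis.piTensorProduct fun j => tensorBasis (β j))
    ((Equiv.arrowCongr ε.symm (Equiv.refl ℕ)).trans (Equiv.piCurry fun _ _ => ℕ))

omit [DecidableEq B] in
theorem sortEquiv_apply
    (ε : (Σ j, β j) ≃ B) (z : ⨂[ℂ] _ : B, V) : sortEquiv ε z = sortFactors ε z := by
  have : (sortEquiv ε).toLinearMap = sortFactors ε := by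
    refine (tensorBasis B).ext fun f => ?_
    rw [LinearEquiv.coe_coe, sortEquiv, Module.Basis.equiv_apply, Basis.piTensorProduct_apply,
      tensorBasis_apply, sortFactors_tprod]
    congr 1
    funext j
    rw [tensorBasis_apply]
    rfl
  exact LinearMap.congr_fun this z

/-- A product of maps into tensor powers of `V`, as a map into the sorted tensor power. -/
def familyMap (ε : (Σ j, β j) ≃ B) {M : J → Type} [∀ j, AddCommGroup (M j)]
    [∀ j, Module ℂ (M j)] (f : ∀ j, M j →ₗ[ℂ] ⨂[ℂ] _ : β j, V) :
    (⨂[ℂ] j, M j) →ₗ[ℂ] ⨂[ℂ] _ : B, V :=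
  (sortEquiv ε).symm.toLinearMap ∘ₗ PiTensorProduct.map f

section

variable (ε : (Σ j, β j) ≃ B) {M : J → Type} [∀ j, AddCommGroup (M j)]
  [∀ j, Module ℂ (M j)] {f : ∀ j, M j →ₗ[ℂ] ⨂[ℂ] _ : β j, V}

omit [∀ j, DecidableEq (β j)] [DecidableEq B] [DecidableEq J] in
theorem familyMap_injective (hf : ∀ j, Function.Injective (f j)) :
    Function.Injective (familyMap ε f) :=
  (sortEquiv ε).symm.injective.comp (map_injective hf)

omit [DecidableEq B] in
theorem sortFactors_familyMap (z : ⨂[ℂ] j, M j) :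
    sortFactors ε (familyMap ε f z) = PiTensorProduct.map f z := by
  rw [← sortEquiv_apply]
  exact (sortEquiv ε).apply_symm_apply _

theorem familyMap_lie {L : Type} [LieRing L] [LieAlgebra ℂ L] [∀ j, LieRingModule L (M j)]
    [∀ j, LieModule ℂ L (M j)] {x : L} {y : Module.End ℂ V}
    (h : ∀ j (m : M j), f j ⁅x, m⁆ = der y (f j m)) (z : ⨂[ℂ] j, M j) :
    familyMap ε f ⁅x, z⁆ = der y (familyMap ε f z) := by
  refine (sortEquiv ε).injective ?_
  rw [sortEquiv_apply, sortEquiv_apply, sortFactors_der, sortFactors_familyMap,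
    sortFactors_familyMap]
  exact map_lie_eq h z

theorem familyMap_tprod_eq_groupAlt (col : B → ℕ) (grp : B → J) (hgrp : ∀ x, grp (ε x) = x.1)
    (t : B → V) {m : ∀ j, M j}
    (h : ∀ j, f j (m j) = colAlt (fun b => col (ε ⟨j, b⟩)) fun b => t (ε ⟨j, b⟩)) :
    familyMap ε f (PiTensorProduct.tprod ℂ m) = groupAlt col grp t := by
  refine (sortEquiv ε).injective ?_
  rw [sortEquiv_apply, sortEquiv_apply, sortFactors_familyMap, PiTensorProduct.map_tprod,
    sortFactors_groupAlt ε col grp hgrp]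
  congr 1
  funext j
  exact h j

end

/-- Maps out of a cyclic module that agree on the generator up to equivariant maps. -/
theorem injective_of_generator {L R X : Type} [LieRing L] [LieAlgebra ℂ L] [AddCommGroup R]
    [Module ℂ R] [LieRingModule L R] [AddCommGroup X] [Module ℂ X] {w : R}
    (hgen : ∀ Y : Submodule ℂ R, w ∈ Y → (∀ (x : L), ∀ z ∈ Y, ⁅x, z⁆ ∈ Y) → Y = ⊤)
    {Ψ Φ : R →ₗ[ℂ] X} {π : Module.End ℂ X} {D : L → Module.End ℂ X}
    (hΨ : ∀ x z, Ψ ⁅x, z⁆ = D x (Ψ z)) (hΦ : ∀ x z, Φ ⁅x, z⁆ = D x (Φ z))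
    (hπ : ∀ x z, π (D x z) = D x (π z)) {n : ℂ} (hn : n ≠ 0) (hw : π (Ψ w) = n • Φ w)
    (hinj : Function.Injective Φ) : Function.Injective Ψ := by
  -- The maps `π ∘ Ψ` and `n • Φ` are both equivariant and agree on the generator `w`, hence
  -- everywhere; a vector killed by `Ψ` is therefore killed by `Φ`.
  have key : LinearMap.ker (π ∘ₗ Ψ - n • Φ) = ⊤ := by
    refine hgen _ ?_ fun x z hz => ?_
    · rw [LinearMap.mem_ker, LinearMap.sub_apply, LinearMap.comp_apply, hw, LinearMap.smul_apply,
        sub_self]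
    · rw [LinearMap.mem_ker, LinearMap.sub_apply, LinearMap.comp_apply, LinearMap.smul_apply]
        at hz ⊢
      rw [hΨ, hΦ, hπ, ← map_smul, ← map_sub, hz, map_zero]
  rw [injective_iff_map_eq_zero]
  intro z hz
  have h : z ∈ LinearMap.ker (π ∘ₗ Ψ - n • Φ) := by rw [key]; trivial
  rw [LinearMap.mem_ker, LinearMap.sub_apply, LinearMap.comp_apply, hz, map_zero,
    LinearMap.smul_apply, zero_sub, neg_eq_zero, smul_eq_zero] at h
  exact (map_eq_zero_iff _ hinj).1 (h.resolve_left hn)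

end

end SlInf

namespace SlInf

open TensorAction

namespace AdmissibleOrder

variable (P : AdmissibleOrder)

/-! ### The comparison maps -/

/-- The inclusion of `V_[p]` in `V`. -/
def blockSpaceIncl (p : ℕ) : P.blockSpace p →ₗ[ℂ] V where
  toFun v := v
  map_add' _ _ := rfl
  map_smul' _ _ := rfl

/-- `S^ν V_[p]` inside the tensor power of `V_[p]`. -/
def sBlockCoe (p : ℕ) (ν : List ℕ) : P.SBlock p ν →ₗ[ℂ] ⨂[ℂ] _ : Box ν, P.blockSpace p where
  toFun v := v
  map_add' _ _ := rfl
  map_smul' _ _ := rfl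

/-- `S^ν V_[p]` inside the tensor power of `V`. -/
def sBlockIncl (p : ℕ) (ν : List ℕ) : P.SBlock p ν →ₗ[ℂ] ⨂[ℂ] _ : Box ν, V :=
  PiTensorProduct.map (fun _ => P.blockSpaceIncl p) ∘ₗ P.sBlockCoe p ν

theorem sBlockIncl_injective (p : ℕ) (ν : List ℕ) : Function.Injective (P.sBlockIncl p ν) := by
  have h : Function.Injective (P.blockSpaceIncl p) := fun _ _ h => Subtype.ext h
  have h' : Function.Injective (P.sBlockCoe p ν) := fun _ _ h => Subtype.ext h
  exact (map_injective fun _ => h).comp h'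

theorem sBlockIncl_lie (p : ℕ) (ν : List ℕ) (x : P.levi) (z : P.SBlock p ν) :
    P.sBlockIncl p ν ⁅x, z⁆ = der ((x : sl) : Module.End ℂ V) (P.sBlockIncl p ν z) := by
  have h : P.sBlockCoe p ν ⁅x, z⁆ =
      der (LieModule.toEnd ℂ P.levi (P.blockSpace p) x) (P.sBlockCoe p ν z) :=
    lie_eq_der x (P.sBlockCoe p ν z)
  rw [sBlockIncl, LinearMap.comp_apply, LinearMap.comp_apply, h]
  exact map_der (f := fun _ => P.blockSpaceIncl p)
    (x := LieModule.toEnd ℂ P.levi (P.blockSpace p) x) (x' := ((x : sl) : Module.End ℂ V))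
    (fun _ v => P.coe_toEnd_blockSpace p x v) (P.sBlockCoe p ν z)

/-- The projection of `V` onto `V_[p]` along the other basis vectors. -/
def blockProj (p : ℕ) : Module.End ℂ V :=
  open Classical in e.constr ℂ fun m => if m ∈ block P.lt p then e m else 0

theorem blockProj_e_of_mem {p m : ℕ} (h : m ∈ block P.lt p) : P.blockProj p (e m) = e m := by
  rw [blockProj, Module.Basis.constr_basis, if_pos h]

theorem blockProj_e_of_notMem {p m : ℕ} (h : m ∉ block P.lt p) : P.blockProj p (e m) = 0 := by
  rw [blockProj, Module.Basis.constr_basis, if_neg h]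

/-- Root vectors of `𝔩(≺)` stay inside one block and Cartan elements are diagonal, so `V` splits
into `V_[p]` and the span of the remaining basis vectors. -/
theorem blockProj_comm (p : ℕ) {x : sl} (hx : x ∈ P.levi) (v : V) :
    P.blockProj p ((x : Module.End ℂ V) v) = (x : Module.End ℂ V) (P.blockProj p v) := by
  have hE : ∀ a b : ℕ, b ∈ block P.lt a → P.blockProj p * E a b = E a b * P.blockProj p := by
    intro a b hab
    refine e.ext fun m => ?_
    rw [Module.End.mul_apply, Module.End.mul_apply, E_apply_e]
    by_cases hm : m ∈ block P.lt p
    · rw [P.blockProj_e_of_mem hm, E_apply_e]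
      split_ifs with h
      · refine P.blockProj_e_of_mem ?_
        rw [← P.block_eq hm, h]
        exact P.mem_block_symm hab
      · rw [map_zero]
    · rw [P.blockProj_e_of_notMem hm, map_zero]
      split_ifs with h
      · refine P.blockProj_e_of_notMem fun ha => hm ?_
        rw [h, ← P.block_eq ha]
        exact hab
      · rw [map_zero]
  have h : ∀ y ∈ Submodule.span ℂ (gens P.sameBlock),
      P.blockProj p * y = y * P.blockProj p := by
    intro y hy
    induction hy using Submodule.span_induction with
    | mem y hy =>
      rcases hy with ⟨a, b, -, hab, rfl⟩ | ⟨a, b, rfl⟩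
      · exact hE a b hab
      · rw [mul_sub, sub_mul, hE a a (P.mem_block_self a), hE b b (P.mem_block_self b)]
    | zero => simp
    | add y z _ _ hy hz => rw [mul_add, add_mul, hy, hz]
    | smul c y _ hy => rw [mul_smul_comm, smul_mul_assoc, hy]
  exact LinearMap.congr_fun (h _ (P.levi_mem_span_gens hx)) v

section

variable (μ : List ℕ) (i : Fin μ.length → ℕ)

/-- The product of the inclusions of the `S^{μ[p]} V_[p]`. -/
def blockIncl : P.BlockTensor μ i →ₗ[ℂ] ⨂[ℂ] _ : Box μ, V :=
  familyMap (P.boxEquiv μ i) fun j : P.BlockIndex i =>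
    P.sBlockIncl (i j.1) (P.subPartition μ i (i j.1))

theorem blockIncl_injective : Function.Injective (P.blockIncl μ i) :=
  familyMap_injective _ fun _ => P.sBlockIncl_injective _ _

theorem blockIncl_lie (x : P.levi) (z : P.BlockTensor μ i) :
    P.blockIncl μ i ⁅x, z⁆ = der ((x : sl) : Module.End ℂ V) (P.blockIncl μ i z) :=
  familyMap_lie (P.boxEquiv μ i) (fun _ m => P.sBlockIncl_lie _ _ x m) z

/-- The group of a box of `μ`: the block of its row. -/
def boxGroup (c : Box μ) : P.BlockIndex i := ((P.boxEquiv μ i).symm c).1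

theorem boxGroup_boxEquiv (x : Σ j : P.BlockIndex i, Box (P.subPartition μ i (i j.1))) :
    P.boxGroup μ i (P.boxEquiv μ i x) = x.1 := by
  rw [boxGroup, Equiv.symm_apply_apply]

variable {i}

theorem sortedEnd_mem_boxGroup (hi : Function.Injective i) (c : Box μ) :
    P.sortedEnd i c.1 ∈ block P.lt (i (P.boxGroup μ i c).1) := by
  obtain ⟨x, rfl⟩ := (P.boxEquiv μ i).surjective c
  rw [boxGroup_boxEquiv, boxEquiv_fst, ← P.block_eq (P.rowOf_mem μ i _ x.2.1)]
  exact P.sortedEnd_mem hi _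

theorem blockIncl_blockVector (hi : Function.Injective i) :
    P.blockIncl μ i (PiTensorProduct.tprod ℂ (P.blockVector μ i)) =
      groupAlt (boxCol μ) (P.boxGroup μ i) fun c => e (P.sortedEnd i c.1) := by
  refine familyMap_tprod_eq_groupAlt (P.boxEquiv μ i) _ _ (P.boxGroup_boxEquiv μ i) _ fun j => ?_
  have h : P.sBlockCoe (i j.1) (P.subPartition μ i (i j.1)) (P.blockVector μ i j) =
      colAlt (boxCol _) fun c => P.blockBasis (i j.1) c.1 := highestWeightVector_eq _ _
  rw [sBlockIncl, LinearMap.comp_apply, h, map_colAlt]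
  congr 1
  funext c
  exact P.coe_blockBasis μ hi (i j.1) c.1

/-- The map from the product of the `S^{μ[p]} V_[p]` to `S^μ V`. -/
def blockToTensor (i : Fin μ.length → ℕ) : P.BlockTensor μ i →ₗ[ℂ] ⨂[ℂ] _ : Box μ, V :=
  colAltMap (boxCol μ) ∘ₗ P.blockIncl μ i

theorem blockToTensor_lie (x : P.levi) (z : P.BlockTensor μ i) :
    P.blockToTensor μ i ⁅x, z⁆ = der ((x : sl) : Module.End ℂ V) (P.blockToTensor μ i z) := by
  rw [blockToTensor, LinearMap.comp_apply, blockIncl_lie, colAltMap_der]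
  rfl

theorem blockToTensor_blockVector (hi : Function.Injective i) :
    ∃ n : ℂ, n ≠ 0 ∧ P.blockToTensor μ i (PiTensorProduct.tprod ℂ (P.blockVector μ i)) =
      n • extremal μ (P.sortedEnd i) := by
  obtain ⟨n, hn, h⟩ := colAltMap_groupAlt (boxCol μ) (P.boxGroup μ i)
    fun c : Box μ => e (P.sortedEnd i c.1)
  refine ⟨n, hn, ?_⟩
  rw [blockToTensor, LinearMap.comp_apply, P.blockIncl_blockVector μ hi, h]
  rfl

-- Projecting every box to the block of its row turns the extremal vector back into the grouped
-- antisymmetrization, which is the image of the generator under the injective `blockIncl`. The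
-- conclusion is `injective_of_generator`.
set_option maxHeartbeats 1000000 in
theorem blockToTensor_injective (hi : Function.Injective i) :
    Function.Injective (P.blockToTensor μ i) := by
  let π : Module.End ℂ (⨂[ℂ] _ : Box μ, V) :=
    PiTensorProduct.map fun c => P.blockProj (i (P.boxGroup μ i c).1)
  have hπ : π (extremal μ (P.sortedEnd i)) =
      P.blockIncl μ i (PiTensorProduct.tprod ℂ (P.blockVector μ i)) := by
    rw [P.blockIncl_blockVector μ hi]
    refine map_colAlt_eq_groupAlt (boxCol μ) (P.boxGroup μ i)
      (f := fun j => P.blockProj (i j.1)) (fun c => ?_) fun c j hcj => ?_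
    · exact P.blockProj_e_of_mem (P.sortedEnd_mem_boxGroup μ hi c)
    · refine P.blockProj_e_of_notMem fun hmem => hcj (BlockIndex.eq_of_block_eq P ?_)
      rw [← P.block_eq (P.sortedEnd_mem_boxGroup μ hi c), ← P.block_eq hmem]
  obtain ⟨n, hn, hv⟩ := P.blockToTensor_blockVector μ hi
  have hcomm : ∀ (x : P.levi) z, π (der ((x : sl) : Module.End ℂ V) z) =
      der ((x : sl) : Module.End ℂ V) (π z) :=
    fun x z => map_der (f := fun c => P.blockProj (i (P.boxGroup μ i c).1))
      (fun c v => P.blockProj_comm _ x.2 v) z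
  clear_value π
  have hw : π (P.blockToTensor μ i (PiTensorProduct.tprod ℂ (P.blockVector μ i))) =
      n • P.blockIncl μ i (PiTensorProduct.tprod ℂ (P.blockVector μ i)) := by
    rw [hv, map_smul, hπ]
  exact injective_of_generator (L := P.levi) (π := π)
    (D := fun x : P.levi => der ((x : sl) : Module.End ℂ V))
    (fun Y h1 h2 => P.blockTensor_eq_top μ i h1 h2) (P.blockToTensor_lie μ)
    (P.blockIncl_lie μ i) hcomm hn hw (P.blockIncl_injective μ i)

theorem extremal_sortedEnd_mem_range (hi : Function.Injective i) :
    extremal μ (P.sortedEnd i) ∈ LinearMap.range (P.blockToTensor μ i) := by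
  obtain ⟨n, hn, hv⟩ := P.blockToTensor_blockVector μ hi
  refine ⟨n⁻¹ • PiTensorProduct.tprod ℂ (P.blockVector μ i), ?_⟩
  rw [map_smul, hv, inv_smul_smul₀ hn]

/-! ### The invariants of `S^μ V` -/

theorem coe_lie_SV (x : sl) (m : SV μ) :
    ((⁅x, m⁆ : SV μ) : ⨂[ℂ] _ : Box μ, V) = der (x : Module.End ℂ V) (m : ⨂[ℂ] _ : Box μ, V) :=
  lie_eq_der x (m : ⨂[ℂ] _ : Box μ, V)

theorem mem_invariants_SV {m : SV μ} : m ∈ P.invariants (SV μ) ↔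
    ∀ a b, P.lt a b → der (E a b) (m : ⨂[ℂ] _ : Box μ, V) = 0 := by
  constructor
  · intro h a b hab
    have hne : a ≠ b := fun h => P.irrefl b (h ▸ hab)
    have := h (rootVector hne) (P.E_mem_nilradical hab rfl)
    have h2 := congrArg Subtype.val this
    rw [coe_lie_SV] at h2
    exact h2
  · intro h
    refine P.mem_invariantSpace_of fun y a b hab hy => Subtype.ext ?_
    rw [coe_lie_SV, hy, h a b hab]
    rfl

theorem extremal_mem_schur {i : Fin μ.length → ℕ} (hi : Function.Injective i) :
    extremal μ i ∈ schur sl e μ := by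
  have h : extremal μ (fun r => (r : ℕ)) ∈ (schur sl e μ).toSubmodule := by
    rw [← highestWeightVector_e]
    exact highestWeightVector_mem_schur e μ
  exact extremal_mem (Z := (schur sl e μ).toSubmodule)
    (fun x z hz => der_mem_schur e μ x hz) Fin.val_injective hi h

/-- Whatever precedes an entry of the sorted left end occurs in an earlier row, so raising that
entry creates a repetition in its column. -/
theorem extremal_sortedEnd_invariant (hμ : μ.Pairwise (· ≥ ·)) (hi : P.IsLeftEnd i) (a b : ℕ)
    (hab : P.lt a b) : der (E a b) (extremal μ (P.sortedEnd i)) = 0 :=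
  der_E_extremal_eq_zero hμ fun s hs => P.exists_sortedEnd_eq hi (by rw [hs]; exact hab)

theorem blockToTensor_mem (hμ : μ.Pairwise (· ≥ ·)) (hi : P.IsLeftEnd i)
    (z : P.BlockTensor μ i) : ∃ h : P.blockToTensor μ i z ∈ schur sl e μ,
      (⟨_, h⟩ : SV μ) ∈ P.invariants (SV μ) := by
  let f : SV μ →ₗ[ℂ] ⨂[ℂ] _ : Box μ, V := (schur sl e μ).toSubmodule.subtype
  let Y : Submodule ℂ (P.BlockTensor μ i) :=
    ((P.invariants (SV μ)).toSubmodule.map f).comap (P.blockToTensor μ i)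
  have hY : Y = ⊤ := by
    refine P.blockTensor_eq_top μ i ?_ fun x z hz => ?_
    · obtain ⟨n, hn, hv⟩ := P.blockToTensor_blockVector μ hi.injective
      rw [Submodule.mem_comap, hv]
      refine Submodule.smul_mem _ _ ⟨⟨_, extremal_mem_schur μ (P.sortedEnd_injective hi.injective)⟩,
        (P.mem_invariants_SV μ).2 ?_, rfl⟩
      exact P.extremal_sortedEnd_invariant μ hμ hi
    · obtain ⟨m, hm, hmz⟩ := hz
      refine ⟨⁅(x : sl), m⁆, (P.invariants (SV μ)).lie_mem (x := x) hm, ?_⟩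
      rw [blockToTensor_lie, ← hmz]
      exact coe_lie_SV μ x m
  have hz : z ∈ Y := by rw [hY]; trivial
  obtain ⟨m, hm, hmz⟩ := hz
  have hmz' : (m : ⨂[ℂ] _ : Box μ, V) = P.blockToTensor μ i z := hmz
  refine ⟨hmz' ▸ m.2, ?_⟩
  have : (⟨P.blockToTensor μ i z, hmz' ▸ m.2⟩ : SV μ) = m := Subtype.ext hmz'.symm
  rw [this]
  exact hm

/-- The triangular decomposition of `𝔰𝔩(∞)`: `𝔩(≺)` preserves the image, raising operators kill it,
and lowering operators stay in `C`. -/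
theorem der_blockToTensor_mem {C : Submodule ℂ (⨂[ℂ] _ : Box μ, V)}
    (hinv : ∀ a b, P.lt a b → ∀ z, der (E a b) (P.blockToTensor μ i z) = 0)
    (hC : LinearMap.range (P.blockToTensor μ i) ≤ C)
    (hlow : ∀ a b, P.lt a b → ∀ z ∈ C, der (E b a) z ∈ C) {x : Module.End ℂ V} (hx : x ∈ sl)
    (z : P.BlockTensor μ i) : der x (P.blockToTensor μ i z) ∈ C := by
  have hlevi : ∀ y ∈ gens P.sameBlock, der y (P.blockToTensor μ i z) ∈ C := by
    intro y hy
    obtain ⟨x, rfl⟩ := P.gens_subset_levi hy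
    rw [← blockToTensor_lie]
    exact hC ⟨_, rfl⟩
  replace hx := mem_span_gens_of_mem_sl hx
  induction hx using Submodule.span_induction with
  | mem y hy =>
    rcases hy with ⟨a, b, hab, -, rfl⟩ | ⟨a, b, rfl⟩
    · by_cases h : b ∈ block P.lt a
      · exact hlevi _ (Or.inl ⟨a, b, hab, h, rfl⟩)
      · rcases P.lt_or_lt_of_notMem h with h | h
        · rw [hinv a b h]; exact C.zero_mem
        · exact hlow b a h _ (hC ⟨z, rfl⟩)
    · exact hlevi _ (Or.inr ⟨a, b, rfl⟩)
  | zero => rw [map_zero, LinearMap.zero_apply]; exact C.zero_mem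
  | add y y' _ _ hy hy' => rw [map_add, LinearMap.add_apply]; exact C.add_mem hy hy'
  | smul c y _ hy => rw [map_smul, LinearMap.smul_apply]; exact C.smul_mem c hy

/-- The closure `C` of the image under lowering operators is stable under all of `𝔰𝔩(∞)`. It
contains one extremal vector, hence the highest weight vector and `S^μ V`. By minimality `C` lies in
the right-hand side, which every lowering operator maps into its second summand. -/
theorem schur_le_range_sup (hμ : μ.Pairwise (· ≥ ·)) (hi : P.IsLeftEnd i) :
    (schur sl e μ).toSubmodule ≤ LinearMap.range (P.blockToTensor μ i) ⊔
      Submodule.span ℂ {y | ∃ a b, P.lt a b ∧ ∃ m : ⨂[ℂ] _ : Box μ, V, y = der (E b a) m} := by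
  let N := LinearMap.range (P.blockToTensor μ i)
  let Y : Set sl := {x | ∃ a b, P.lt a b ∧ (x : Module.End ℂ V) = E b a}
  have hbr : ∀ (x : sl) (z : ⨂[ℂ] _ : Box μ, V), ⁅x, z⁆ = der (x : Module.End ℂ V) z :=
    fun x z => lie_eq_der (x : Module.End ℂ V) z
  let C : Submodule ℂ (⨂[ℂ] _ : Box μ, V) := sInf {Z | N ≤ Z ∧ ∀ y ∈ Y, ∀ z ∈ Z, ⁅y, z⁆ ∈ Z}
  have hNC : N ≤ C := le_sInf fun Z hZ => hZ.1
  have hYC : ∀ y ∈ Y, ∀ z ∈ C, ⁅y, z⁆ ∈ C := fun y hy z hz =>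
    Submodule.mem_sInf.2 fun Z hZ => hZ.2 y hy z (Submodule.mem_sInf.1 hz Z hZ)
  have hlow : ∀ a b, P.lt a b → ∀ z ∈ C, der (E b a) z ∈ C := by
    intro a b hab z hz
    have hne : b ≠ a := fun h => P.irrefl a (by rw [h] at hab; exact hab)
    have := hYC (rootVector hne) ⟨a, b, hab, rfl⟩ z hz
    rwa [hbr] at this
  have hinv : ∀ a b, P.lt a b → ∀ z, der (E a b) (P.blockToTensor μ i z) = 0 := by
    intro a b hab z
    obtain ⟨h1, h2⟩ := P.blockToTensor_mem μ hμ hi z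
    exact (P.mem_invariants_SV μ).1 h2 a b hab
  have hstab : ∀ (x : sl), ∀ z ∈ C, der (x : Module.End ℂ V) z ∈ C := by
    intro x z hz
    rw [← hbr]
    refine lie_mem_of_closure Y N C (fun Z h1 h2 => sInf_le ⟨h1, h2⟩) hNC hYC ?_ x hz
    rintro x _ ⟨z, rfl⟩
    rw [hbr]
    exact P.der_blockToTensor_mem μ hinv hNC hlow x.2 z
  have hMC : (schur sl e μ).toSubmodule ≤ C := by
    refine schur_le e μ ?_ hstab
    rw [highestWeightVector_e]
    exact extremal_mem hstab (P.sortedEnd_injective hi.injective) Fin.val_injective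
      (hNC (P.extremal_sortedEnd_mem_range μ hi.injective))
  refine hMC.trans (sInf_le ⟨le_sup_left, ?_⟩)
  rintro y ⟨a, b, hab, hy⟩ z -
  rw [hbr, hy]
  exact Submodule.mem_sup_right (Submodule.subset_span ⟨a, b, hab, z, rfl⟩)

theorem exists_blockToTensor_eq (hμ : μ.Pairwise (· ≥ ·)) (hi : P.IsLeftEnd i) {m : SV μ}
    (hm : m ∈ P.invariants (SV μ)) : ∃ z, P.blockToTensor μ i z = m := by
  obtain ⟨_, ⟨z, rfl⟩, d, hd, hmd⟩ := Submodule.mem_sup.1 (P.schur_le_range_sup μ hμ hi m.2)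
  refine ⟨z, ?_⟩
  have h0 : ∀ a b, P.lt a b → der (E a b) d = 0 := by
    intro a b hab
    obtain ⟨h1, h2⟩ := P.blockToTensor_mem μ hμ hi z
    have h3 := (P.mem_invariants_SV μ).1 h2 a b hab
    have h4 := (P.mem_invariants_SV μ).1 hm a b hab
    rw [← hmd, map_add] at h4
    rwa [show der (E a b) (P.blockToTensor μ i z) = 0 from h3, zero_add] at h4
  -- The difference `d` of two invariants is killed by all raising operators and is a sum of lowered
  -- vectors, so it vanishes.
  rw [← hmd, eq_zero_of_mem_span_der h0 hd, add_zero]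

/-- The product of the `S^{μ[p]} V_[p]` is isomorphic to the invariants of `S^μ V`. -/
def blockTensorEquiv (hμ : μ.Pairwise (· ≥ ·)) (hi : P.IsLeftEnd i) :
    P.BlockTensor μ i ≃ₗ⁅ℂ, P.levi⁆ P.invariants (SV μ) :=
  let f : P.BlockTensor μ i →ₗ[ℂ] P.invariants (SV μ) :=
    { toFun := fun z => ⟨⟨P.blockToTensor μ i z, (P.blockToTensor_mem μ hμ hi z).1⟩,
        (P.blockToTensor_mem μ hμ hi z).2⟩
      map_add' := fun y z => Subtype.ext (Subtype.ext (map_add _ _ _))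
      map_smul' := fun c z => Subtype.ext (Subtype.ext (map_smul _ _ _)) }
  { LinearEquiv.ofBijective f ⟨fun y z h => P.blockToTensor_injective μ hi.injective
        (congrArg (fun m : P.invariants (SV μ) => (m.1.1 : ⨂[ℂ] _ : Box μ, V)) h), fun m => by
      obtain ⟨z, hz⟩ := P.exists_blockToTensor_eq μ hμ hi m.2
      exact ⟨z, Subtype.ext (Subtype.ext hz)⟩⟩ with
    map_lie' := fun {x z} => Subtype.ext (Subtype.ext ((P.blockToTensor_lie μ x z).trans
      (coe_lie_SV μ (x : sl) (f z).1).symm)) }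

end

end AdmissibleOrder

/-- Tensoring with the trivial module does nothing. -/
def tensorTrivialEquiv (L M : Type) [LieRing L] [LieAlgebra ℂ L] [AddCommGroup M] [Module ℂ M]
    [LieRingModule L M] [LieModule ℂ L M] : M ⊗[ℂ] TrivialLieModule ℂ L ℂ ≃ₗ⁅ℂ, L⁆ M :=
  let r : M ⊗[ℂ] TrivialLieModule ℂ L ℂ ≃ₗ[ℂ] M := TensorProduct.rid ℂ M
  { r with
    map_lie' := fun {x z} => by
      change r ⁅x, z⁆ = ⁅x, r z⁆
      induction z using TensorProduct.induction_on with
      | zero => rw [lie_zero, map_zero, lie_zero]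
      | add y z hy hz => rw [lie_add, map_add, hy, hz, map_add, lie_add]
      | tmul m c =>
        have hr : ∀ m : M, r (m ⊗ₜ[ℂ] c) = (show ℂ from c) • m := fun m =>
          TensorProduct.rid_tmul (R := ℂ) m c
        rw [TensorProduct.LieModule.lie_tmul_right, trivial_lie_zero L (TrivialLieModule ℂ L ℂ),
          TensorProduct.tmul_zero, add_zero, hr, hr, lie_smul] }

end SlInf

end

theorem mainTheorem11 (P : SlInf.AdmissibleOrder) (μ : List ℕ) (hμ : μ.Pairwise (· ≥ ·))
    (hpos : ∀ a ∈ μ, 0 < a) (hne : μ ≠ []) (hal : P.IsAligned (SlInf.SV μ)) :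
    (∃ i : Fin μ.length → ℕ, P.IsLeftEnd i) ∧
      ∀ i : Fin μ.length → ℕ, P.IsLeftEnd i →
        Nonempty (P.invariants (SlInf.SV μ) ≃ₗ⁅ℂ, P.levi⁆
          ((⨂[ℂ] j : P.BlockIndex i, P.SBlock (i j.1) (P.subPartition μ i (i j.1))) ⊗[ℂ]
            TrivialLieModule ℂ P.levi ℂ)) := by
  refine ⟨?_, fun i hi => ⟨(P.blockTensorEquiv μ hμ hi).symm.trans
    (SlInf.tensorTrivialEquiv P.levi (P.BlockTensor μ i)).symm⟩⟩
  obtain ⟨m, hm0, hm⟩ := SlInf.AdmissibleOrder.IsAligned.exists_invariant P hal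
  exact P.exists_isLeftEnd_of_invariant hpos m.2 (fun h => hm0 (Subtype.ext h))
    ((P.mem_invariants_SV μ).1 hm)
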